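/- **Conventions.** Let $(X,\bullet)$ be a pointed diffeological space. A *smooth path* in a diffeological space $Y$ is a smooth map from a nonempty open interval of $\mathbb R$ to $Y$. The set $\mathcal PY$ of smooth paths carries the functional diffeology: $r\mapsto\alpha_r$ is a plot iff for all $r_0$ and $s_0\in\mathrm{dom}(\alpha_{r_0})$ there are open $V\ni r_0$, $W\ni s_0$ with $W\subseteq\mathrm{dom}(\alpha_r)$ for all $r\in V$ and $(r,s)\mapsto\alpha_r(s)$ smooth on $V\times W$. Put $\hat{\mathcal P}Y=\{(\alpha,t)\in\mathcal PY\times\mathbb R: t\in\mathrm{dom}(\alpha)\}$. $X$ is path-connected if any two points lie on a common smooth path. *Path classes.* For $\alpha,\beta\in C^\infty([0,1],X)$ with $\alpha(1)=\beta(0)$ let $\beta\vee\alpha$ be the concatenation "first $\alpha$, then $\beta$", each of the two paths being first composed with a fixed smooth map $[0,1]\to[0,1]$ that is $0$ near $0$ and $1$ near $1$. *Retrace equivalence* is the smallest equivalence relation on $C^\infty([0,1],X)$ that is compatible with $\vee$ and satisfies $\alpha\circ f\sim\alpha$ for every smooth $f:[0,1]\to[0,1]$ with $f(0)=0$, $f(1)=1$,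 and $\beta\vee\eta\vee\eta^{\leftarrow}\vee\alpha\sim\beta\vee\alpha$, where $\eta^{\leftarrow}(t)=\eta(1-t)$. Let $\mathcal F(X)$ be the quotient, with the quotient diffeology, and, with the subspace diffeologies, $\mathcal F_\bullet(X)=\{[\alpha]:\alpha(0)=\bullet\}$ and $\Omega_\bullet(X)=\{[\gamma]:\gamma(0)=\bullet=\gamma(1)\}$. The latter is a group under $[\gamma][\sigma]=[\gamma\vee\sigma]$, $[\gamma]^{-1}=[\gamma^{\leftarrow}]$, and acts on $\mathcal F_\bullet(X)$ from the right by $[\alpha][\gamma]=[\alpha\vee\gamma]$. Put $\tau([\alpha])=\alpha(1)$. *Bundles and connections.* Let $G$ be a diffeological group acting smoothly from the right on a diffeological space $E$. A smooth surjection $\pi:E\to X$ is a *diffeological principal $G$-bundle* if $(\xi,g)\mapsto(\xi,\xi g)$ is a diffeomorphism from $E\times G$ onto its image in $E\times E$, and there is a diffeomorphism $\Phi:X\to E/G$ with $\Phi(\pi(\xi))=\xi G$. A *diffeological connection* on it is a smooth map $A:\hat{\mathcal P}E\to\mathcal PE$, $(\alpha,t)\mapsto A_t\alpha$, such that $\mathrm{dom}(A_t\alpha)=\mathrm{dom}(\alpha)$;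 $\pi\circ A_t\alpha=\pi\circ\alpha$; $A_t\alpha(t)=\alpha(t)$; $A_t(\alpha\cdot\rho)=A_t\alpha\cdot\rho(t)$ for smooth $\rho:\mathrm{dom}(\alpha)\to G$; $A_t(\alpha\circ f)=A_{f(t)}\alpha\circ f$ for smooth paths $f$ in $\mathrm{dom}(\alpha)$; and $A_t(A_t\alpha)=A_t\alpha$. A path $\beta$ in $E$ is *$A$-horizontal* if $A_t\beta=\beta$ for some $t\in\mathrm{dom}(\beta)$. A smooth loop at $\bullet$ is a smooth path $\gamma$ in $X$ with $0,1\in\mathrm{dom}(\gamma)$ and $\gamma(0)=\bullet=\gamma(1)$. For $\xi_0\in\pi^{-1}(\bullet)$, an element $g\in G$ is a *holonomy of $A$ along $\gamma$ at $\xi_0$* if some $A$-horizontal path $\beta$ with $\pi\circ\beta=\gamma$ and $\beta(0)=\xi_0$ satisfies $\beta(1)=\xi_0\cdot g$; the *holonomy group* $\mathrm{Hol}_{\xi_0}(A)$ is the set of all these $g$, for all smooth loops $\gamma$ at $\bullet$. **Theorem (Diffeological Kobayashi Theorem).** Let $(X,\bullet)$ be a path-connected pointed diffeological space, $G$ a diffeological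 group, and $H:\Omega_\bullet(X)\to G$ a smooth group homomorphism. Let $\mathcal F_\bullet(X)\times_H G$ be the quotient of $\mathcal F_\bullet(X)\times G$ by the right action $(p,h)\omega=(p\,\omega,H(\omega)^{-1}h)$ of $\Omega_\bullet(X)$, with the quotient diffeology, the right $G$-action $\llbracket p,h\rrbracket k=\llbracket p,hk\rrbracket$, and the projection $\tau_H(\llbracket p,h\rrbracket)=\tau(p)$. For $(\xi,r)\in\hat{\mathcal P}(\mathcal F_\bullet(X)\times_H G)$ with $\xi(r)=\llbracket[\beta],g\rrbracket$ put $$\Theta^H_r\xi(s)=\llbracket[(\tau_H\circ\xi)^{r\to s}\vee\beta],\,g\rrbracket,\qquad \alpha^{r\to s}(t)=\alpha(ts+(1-t)r)\quad(t\in[0,1]).$$ Then: 1. $\tau_H:\mathcal F_\bullet(X)\times_H G\to X$ is a diffeological principal $G$-bundle, and $\Theta^H$ is a diffeological connection on it. 2. Let $e\in G$ be the neutral element and $\llbracket\bullet,e\rrbracket$ the class of (constant path at $\bullet$, $e$), which lies over $\bullet$. For every smooth loop $\gamma$ at $\bullet$, the element $H([\gamma|_{[0,1]}])$ is the one and only holonomy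 of $\Theta^H$ along $\gamma$ at $\llbracket\bullet,e\rrbracket$. Every element of $\Omega_\bullet(X)$ is of the form $[\gamma|_{[0,1]}]$ for such a loop $\gamma$, so the holonomy representation of $\Theta^H$ at $\llbracket\bullet,e\rrbracket$, as a map $\Omega_\bullet(X)\to G$, is $H$. 3. $\mathrm{Hol}_{\llbracket\bullet,e\rrbracket}(\Theta^H)=H(\Omega_\bullet(X))$. -/

import Mathlib

open Diffeology
open scoped ContDiff Topology unitInterval

noncomputable section

namespace Diffeology

/-! ### Basic constructions of diffeologies

A diffeology is Mathlib's `DiffeologicalSpace`, given by its globally defined plots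
`ℝⁿ → X`. A plot on an open set `U ⊆ ℝⁿ` is a map `U → X` that is `DSmooth` for the subspace
diffeology on `U`. -/

/-- The Euclidean space `ℝⁿ`. -/
abbrev Euc (n : ℕ) : Type := EuclideanSpace ℝ (Fin n)

/-- Every open neighbourhood `u` of a point `x` of `ℝⁿ` receives a smooth map from `ℝⁿ` which is
the identity near `x`. In particular every plot on `u` agrees near `x` with a global one. -/
theorem exists_smooth_shrink {n : ℕ} {x : Euc n} {u : Set (Euc n)} (hu : IsOpen u) (hx : x ∈ u) :
    ∃ ρ : Euc n → Euc n, ContDiff ℝ ∞ ρ ∧ (∀ y, ρ y ∈ u) ∧ ∀ᶠ y in 𝓝 x, ρ y = y := by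
  obtain ⟨ε, hε, hb⟩ := Metric.isOpen_iff.mp hu x hx
  let f : ContDiffBump x := ⟨ε / 4, ε / 2, by positivity, by linarith⟩
  refine ⟨fun y => x + f y • (y - x), ?_, fun y => hb ?_, ?_⟩
  · exact contDiff_const.add (f.contDiff.smul (contDiff_id.sub contDiff_const))
  · rw [Metric.mem_ball, dist_eq_norm, add_sub_cancel_left, norm_smul, Real.norm_eq_abs,
      abs_of_nonneg f.nonneg]
    by_cases hy : dist y x < ε / 2
    · have h1 : f y ≤ 1 := f.le_one
      rw [dist_eq_norm] at hy
      nlinarith [norm_nonneg (y - x), f.nonneg (x := y)]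
    · rw [f.zero_of_le_dist (not_lt.mp hy)]
      simpa using hε
  · filter_upwards [f.eventuallyEq_one] with y hy
    simp [hy]

/-- Subspace diffeology: the plots are the plots of the ambient space with values in the
subset. -/
instance instSubtype {X : Type*} [DiffeologicalSpace X] (s : X → Prop) :
    DiffeologicalSpace (Subtype s) where
  plots n := {p : Euc n → Subtype s | IsPlot fun x => (p x).1}
  constant_plots _ := isPlot_const
  plot_reparam hp hf := isPlot_reparam hp hf
  locality h := DiffeologicalSpace.locality h

/-- Product diffeology: a map is a plot iff both of its components are. -/
instance instProd {X Y : Type*} [DiffeologicalSpace X] [DiffeologicalSpace Y] :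
    DiffeologicalSpace (X × Y) where
  plots n := {p : Euc n → X × Y | (IsPlot fun x => (p x).1) ∧ IsPlot fun x => (p x).2}
  constant_plots _ := ⟨isPlot_const, isPlot_const⟩
  plot_reparam hp hf := ⟨isPlot_reparam hp.1 hf, isPlot_reparam hp.2 hf⟩
  locality h := by
    refine ⟨DiffeologicalSpace.locality fun x => ?_, DiffeologicalSpace.locality fun x => ?_⟩
    · obtain ⟨u, hu, hx, H⟩ := h x
      exact ⟨u, hu, hx, fun hf hf' => (H hf hf').1⟩
    · obtain ⟨u, hu, hx, H⟩ := h x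
      exact ⟨u, hu, hx, fun hf hf' => (H hf hf').2⟩

/-- Quotient diffeology: the plots are the maps which lift locally to plots of the space upstairs.
(By `exists_smooth_shrink` the local lifts may be taken to be restrictions of global plots.) -/
instance instQuotient {X : Type*} [DiffeologicalSpace X] (s : Setoid X) :
    DiffeologicalSpace (Quotient s) where
  plots n := {p : Euc n → Quotient s |
    ∀ x, ∃ q : Euc n → X, IsPlot q ∧ ∀ᶠ y in 𝓝 x, p y = Quotient.mk s (q y)}
  constant_plots c := by
    obtain ⟨a, rfl⟩ := Quotient.exists_rep c
    exact fun _ => ⟨fun _ => a, isPlot_const, by simp⟩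
  plot_reparam := by
    intro n m p f hp hf x
    obtain ⟨q, hq, h⟩ := hp (f x)
    exact ⟨q ∘ f, isPlot_reparam hq hf, hf.continuous.continuousAt.eventually h⟩
  locality := by
    intro n p h x
    obtain ⟨u, hu, hx, H⟩ := h x
    obtain ⟨ρ, hρ, hρu, hid⟩ := exists_smooth_shrink hu hx
    obtain ⟨q, hq, h'⟩ := H hρu hρ x
    refine ⟨q, hq, ?_⟩
    filter_upwards [hid, h'] with y h1 h2
    simpa [h1] using h2

/-- The set `C^∞(X, Y)` of smooth maps. -/
@[ext]
structure SmoothMap (X Y : Type*) [DiffeologicalSpace X] [DiffeologicalSpace Y] where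
  toFun : X → Y
  smooth : DSmooth toFun

instance {X Y : Type*} [DiffeologicalSpace X] [DiffeologicalSpace Y] :
    CoeFun (SmoothMap X Y) fun _ => X → Y := ⟨SmoothMap.toFun⟩

/-- Composition of smooth maps. -/
def SmoothMap.comp {X Y Z : Type*} [DiffeologicalSpace X] [DiffeologicalSpace Y]
    [DiffeologicalSpace Z] (g : SmoothMap Y Z) (f : SmoothMap X Y) : SmoothMap X Z :=
  ⟨g.toFun ∘ f.toFun, g.smooth.comp f.smooth⟩

/-- Functional diffeology: `r ↦ p r` is a plot iff `(r, x) ↦ p r x` is smooth. -/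
instance instSmoothMap {X Y : Type*} [DiffeologicalSpace X] [DiffeologicalSpace Y] :
    DiffeologicalSpace (SmoothMap X Y) where
  plots n := {p : Euc n → SmoothMap X Y | DSmooth fun q : Euc n × X => p q.1 q.2}
  constant_plots f := fun _ _ hq => hq.2.dSmooth_comp f.smooth
  plot_reparam := by
    intro n m p f hp hf k q hq
    exact hp k (fun x => (f (q x).1, (q x).2)) ⟨hq.1.dSmooth_comp hf.dSmooth, hq.2⟩
  locality := by
    intro n p h k q hq
    refine DiffeologicalSpace.locality fun x => ?_
    obtain ⟨u, hu, hx, H⟩ := h (q x).1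
    have hc : ContDiff ℝ ∞ fun y => (q y).1 := hq.1.contDiff
    refine ⟨(fun y => (q y).1) ⁻¹' u, hu.preimage hc.continuous, hx, ?_⟩
    intro m f hfu hf
    exact H (f := fun z => (q (f z)).1) hfu (hc.comp hf) m (fun z => (z, (q (f z)).2))
      ⟨isPlot_id, isPlot_reparam hq.2 hf⟩

/-- A diffeomorphism: a smooth bijection with smooth inverse. -/
structure Diffeo (X Y : Type*) [DiffeologicalSpace X] [DiffeologicalSpace Y] extends X ≃ Y where
  smooth_toFun : DSmooth toFun
  smooth_invFun : DSmooth invFun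

/-- A diffeological group: multiplication and inversion are smooth. -/
class DiffeologicalGroup (G : Type*) [Group G] [DiffeologicalSpace G] : Prop where
  smooth_mul : DSmooth fun p : G × G => p.1 * p.2
  smooth_inv : DSmooth fun g : G => g⁻¹

/-! ### Smooth paths on open intervals -/

/-- A smooth path in `Y`: a smooth map from an open interval `dom ⊆ ℝ` to `Y`. -/
structure SmoothPath (Y : Type*) [DiffeologicalSpace Y] where
  dom : Set ℝ
  isOpen_dom : IsOpen dom
  ordConnected_dom : dom.OrdConnected
  nonempty_dom : dom.Nonempty
  toFun : dom → Y
  smooth : DSmooth toFun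

instance {Y : Type*} [DiffeologicalSpace Y] :
    CoeFun (SmoothPath Y) fun α => α.dom → Y := ⟨SmoothPath.toFun⟩

/-- The functional diffeology on the path space `𝒫Y`: a family `r ↦ p r` of paths is a plot iff
for all `r₀` and `s₀ ∈ dom (p r₀)` there are open neighbourhoods `V` of `r₀` and `W` of `s₀` with
`W ⊆ dom (p r)` for all `r ∈ V`, and such that `(r, s) ↦ p r s` is smooth on `V × W`. -/
instance instSmoothPath {Y : Type*} [DiffeologicalSpace Y] : DiffeologicalSpace (SmoothPath Y) where
  plots n := {p : Euc n → SmoothPath Y | ∀ r₀, ∀ s₀ ∈ (p r₀).dom,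
    ∃ (V : Set (Euc n)) (W : Set ℝ) (h : ∀ r ∈ V, W ⊆ (p r).dom),
      IsOpen V ∧ IsOpen W ∧ r₀ ∈ V ∧ s₀ ∈ W ∧
        DSmooth fun q : V × W => p q.1.1 ⟨q.2.1, h q.1.1 q.1.2 q.2.2⟩}
  constant_plots α := by
    intro r₀ s₀ hs
    exact ⟨Set.univ, α.dom, fun _ _ => subset_rfl, isOpen_univ, α.isOpen_dom, trivial, hs,
      fun _ _ hq => hq.2.dSmooth_comp α.smooth⟩
  plot_reparam := by
    intro n m p f hp hf r₀ s₀ hs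
    obtain ⟨V, W, h, hV, hW, hr, hs', H⟩ := hp (f r₀) s₀ hs
    refine ⟨f ⁻¹' V, W, fun r hr => h _ hr, hV.preimage hf.continuous, hW, hr, hs', ?_⟩
    intro k q hq
    exact H k (fun x => (⟨f (q x).1.1, (q x).1.2⟩, (q x).2))
      ⟨IsPlot.dSmooth_comp (p := fun x => (q x).1.1) hq.1 hf.dSmooth, hq.2⟩
  locality := by
    intro n p h r₀ s₀ hs
    obtain ⟨u, hu, hx, H⟩ := h r₀
    obtain ⟨ρ, hρ, hρu, hid⟩ := exists_smooth_shrink hu hx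
    obtain ⟨u', hu'sub, hu', hxu'⟩ := eventually_nhds_iff.mp hid
    have hr₀ : ρ r₀ = r₀ := hu'sub _ hxu'
    obtain ⟨V, W, h, hV, hW, hr, hs', H⟩ := H hρu hρ r₀ s₀ (by simpa [hr₀] using hs)
    have key : ∀ r ∈ V ∩ u', p (ρ r) = p r := fun r hr => by rw [hu'sub r hr.2]
    refine ⟨V ∩ u', W, fun r hr => by rw [← key r hr]; exact h r hr.1, hV.inter hu', hW,
      ⟨hr, hxu'⟩, hs', ?_⟩
    intro k q hq
    have aux : ∀ (α β : SmoothPath Y) (s : ℝ) (h₁ : s ∈ α.dom) (h₂ : s ∈ β.dom), α = β →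
        α ⟨s, h₁⟩ = β ⟨s, h₂⟩ := by
      rintro α _ s h₁ h₂ rfl
      rfl
    convert H k (fun x => (⟨(q x).1.1, (q x).1.2.1⟩, (q x).2)) ⟨hq.1, hq.2⟩ using 1
    funext x
    exact aux _ _ _ _ _ (key _ (q x).1.2).symm

/-- The initialized path space `𝒫̂Y` of pairs `(α, t)` with `t ∈ dom α`, with the subspace
diffeology from `𝒫Y × ℝ`. -/
abbrev InitPath (Y : Type*) [DiffeologicalSpace Y] : Type _ :=
  {p : SmoothPath Y × ℝ // p.2 ∈ p.1.dom}

/-- The path of `p = (α, t)`. -/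
abbrev InitPath.path {Y : Type*} [DiffeologicalSpace Y] (p : InitPath Y) : SmoothPath Y := p.1.1

/-- The initial time of `p = (α, t)`, as a point of the domain of `α`. -/
def InitPath.time {Y : Type*} [DiffeologicalSpace Y] (p : InitPath Y) : p.path.dom := ⟨p.1.2, p.2⟩

/-- `(α, t)` as an initialized path. -/
def SmoothPath.at {Y : Type*} [DiffeologicalSpace Y] (α : SmoothPath Y) (t : α.dom) : InitPath Y :=
  ⟨(α, t.1), t.2⟩

/-- The image `f ∘ α` of a path under a smooth map. -/
def SmoothPath.map {Y Z : Type*} [DiffeologicalSpace Y] [DiffeologicalSpace Z]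
    (α : SmoothPath Y) (f : Y → Z) (hf : DSmooth f) : SmoothPath Z where
  dom := α.dom
  isOpen_dom := α.isOpen_dom
  ordConnected_dom := α.ordConnected_dom
  nonempty_dom := α.nonempty_dom
  toFun := f ∘ α.toFun
  smooth := hf.comp α.smooth

/-- The reparametrization `α ∘ f` of a path `α` along a smooth path `f` in the domain of `α`. -/
def SmoothPath.reparam {Y : Type*} [DiffeologicalSpace Y] (α : SmoothPath Y)
    (f : SmoothPath α.dom) : SmoothPath Y := f.map α.toFun α.smooth

/-- A diffeological space is path-connected if any two points lie on a common smooth path. -/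
def PathConnected (X : Type*) [DiffeologicalSpace X] : Prop :=
  ∀ x y : X, ∃ (α : SmoothPath X) (s t : α.dom), α s = x ∧ α t = y

/-! ### Principal bundles and connections

A right action of `G` on `E` is a `MulAction` of `Gᵐᵒᵖ`; the point `ξ · g` is
`MulOpposite.op g • ξ`. -/

/-- The right action of `G` on `E` is smooth. -/
class SmoothRightAction (G E : Type*) [Group G] [DiffeologicalSpace G] [DiffeologicalSpace E]
    [MulAction Gᵐᵒᵖ E] : Prop where
  smooth_act : DSmooth fun p : E × G => MulOpposite.op p.2 • p.1

/-- A diffeological principal `G`-bundle: a smooth surjection `π : E → X` such that the map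
`(ξ, g) ↦ (ξ, ξ g)` is a diffeomorphism onto its image, and such that `π` induces a
diffeomorphism between `X` and the orbit space `E / G`. -/
structure IsPrincipalBundle (G : Type*) {E X : Type*} [Group G] [DiffeologicalSpace G]
    [DiffeologicalGroup G] [DiffeologicalSpace E] [DiffeologicalSpace X] [MulAction Gᵐᵒᵖ E]
    [SmoothRightAction G E] (π : E → X) : Prop where
  smooth : DSmooth π
  surjective : Function.Surjective π
  graph : ∃ Γ : Diffeo (E × G) (Set.range fun p : E × G => (p.1, MulOpposite.op p.2 • p.1)),
    ∀ p : E × G, (Γ.toEquiv p : E × E) = (p.1, MulOpposite.op p.2 • p.1)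
  orbit : ∃ Φ : Diffeo X (Quotient (MulAction.orbitRel Gᵐᵒᵖ E)),
    ∀ ξ : E, Φ.toEquiv (π ξ) = Quotient.mk _ ξ

/-- The path `s ↦ α s · ρ s`. -/
def SmoothPath.mulRight {G E : Type*} [Group G] [DiffeologicalSpace G] [DiffeologicalSpace E]
    [MulAction Gᵐᵒᵖ E] [SmoothRightAction G E] (α : SmoothPath E) (ρ : α.dom → G)
    (hρ : DSmooth ρ) : SmoothPath E where
  dom := α.dom
  isOpen_dom := α.isOpen_dom
  ordConnected_dom := α.ordConnected_dom
  nonempty_dom := α.nonempty_dom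
  toFun := fun s => MulOpposite.op (ρ s) • α s
  smooth := fun n p hp => (SmoothRightAction.smooth_act (G := G) (E := E)) n
    (fun x => (α (p x), ρ (p x))) ⟨hp.dSmooth_comp α.smooth, hp.dSmooth_comp hρ⟩

/-- A diffeological connection on a principal `G`-bundle `π : E → X`: a smooth map
`A : 𝒫̂E → 𝒫E`, written `(α, t) ↦ A_t α`, with the six properties below. Identities between paths
are stated pointwise where the two sides have the same domain by `domain`. -/
structure IsConnection (G : Type*) {E X : Type*} [Group G] [DiffeologicalSpace G]
    [DiffeologicalSpace E] [DiffeologicalSpace X] [MulAction Gᵐᵒᵖ E]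
    [SmoothRightAction G E] (π : E → X) (A : InitPath E → SmoothPath E) : Prop where
  smooth : DSmooth A
  /-- `dom (A_t α) = dom α` -/
  domain : ∀ p, (A p).dom = p.path.dom
  /-- `π ∘ A_t α = π ∘ α` -/
  lifting : ∀ p s (h : s ∈ (A p).dom) (h' : s ∈ p.path.dom), π (A p ⟨s, h⟩) = π (p.path ⟨s, h'⟩)
  /-- `A_t α (t) = α (t)` -/
  basepoint : ∀ p (h : p.time.1 ∈ (A p).dom), A p ⟨p.time.1, h⟩ = p.path p.time
  /-- `A_t (α · ρ) = A_t α · ρ(t)` -/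
  equivariant : ∀ (α : SmoothPath E) (t : α.dom) (ρ : α.dom → G) (hρ : DSmooth ρ) (s : ℝ)
    (h : s ∈ (A ((α.mulRight ρ hρ).at t)).dom) (h' : s ∈ (A (α.at t)).dom),
    A ((α.mulRight ρ hρ).at t) ⟨s, h⟩ = MulOpposite.op (ρ t) • A (α.at t) ⟨s, h'⟩
  /-- `A_t (α ∘ f) = A_{f(t)} α ∘ f` -/
  reparam : ∀ (α : SmoothPath E) (f : SmoothPath α.dom) (t s : f.dom)
    (h : s.1 ∈ (A ((α.reparam f).at t)).dom) (h' : (f s).1 ∈ (A (α.at (f t))).dom),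
    A ((α.reparam f).at t) ⟨s.1, h⟩ = A (α.at (f t)) ⟨(f s).1, h'⟩
  /-- `A_t (A_t α) = A_t α` -/
  projection : ∀ p (h : p.time.1 ∈ (A p).dom), A ((A p).at ⟨p.time.1, h⟩) = A p

/-- A path `β` is `A`-horizontal if `A_t β = β` for some `t ∈ dom β`. -/
def IsHorizontal {E : Type*} [DiffeologicalSpace E] (A : InitPath E → SmoothPath E)
    (β : SmoothPath E) : Prop := ∃ t : β.dom, A (β.at t) = β

/-- `β` is a horizontal lift of `α` with value `ξ` at time `t`. -/
def IsHorizontalLift {E X : Type*} [DiffeologicalSpace E] [DiffeologicalSpace X] (π : E → X)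
    (A : InitPath E → SmoothPath E) (α : SmoothPath X) (t : ℝ) (ξ : E) (β : SmoothPath E) : Prop :=
  IsHorizontal A β ∧ β.dom = α.dom ∧
    (∀ s (h : s ∈ β.dom) (h' : s ∈ α.dom), π (β ⟨s, h⟩) = α ⟨s, h'⟩) ∧
    ∃ h : t ∈ β.dom, β ⟨t, h⟩ = ξ

/-- A smooth loop based at `x₀`: a smooth path `γ` with `0, 1 ∈ dom γ` and
`γ(0) = x₀ = γ(1)`. -/
structure SmoothLoop (X : Type*) [DiffeologicalSpace X] (x₀ : X) extends SmoothPath X where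
  zero_mem : (0 : ℝ) ∈ dom
  one_mem : (1 : ℝ) ∈ dom
  map_zero : toFun ⟨0, zero_mem⟩ = x₀
  map_one : toFun ⟨1, one_mem⟩ = x₀

/-- `g` is the holonomy of `A` along the loop `γ` at the point `ξ₀` over `x₀`: a horizontal lift of
`γ` starting at `ξ₀` at time `0` arrives at `ξ₀ · g` at time `1`. -/
def HasHolonomy {G E X : Type*} [Group G] [DiffeologicalSpace E] [DiffeologicalSpace X]
    [MulAction Gᵐᵒᵖ E] (π : E → X) (A : InitPath E → SmoothPath E) {x₀ : X} (ξ₀ : E)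
    (γ : SmoothLoop X x₀) (g : G) : Prop :=
  ∃ β : SmoothPath E, IsHorizontalLift π A γ.toSmoothPath 0 ξ₀ β ∧
    ∃ h : (1 : ℝ) ∈ β.dom, β ⟨1, h⟩ = MulOpposite.op g • ξ₀

/-- The holonomy group of `A` at `ξ₀`: all holonomies along smooth loops based at `π ξ₀`. -/
def holonomyGroup (G : Type*) {E X : Type*} [Group G] [DiffeologicalSpace E] [DiffeologicalSpace X]
    [MulAction Gᵐᵒᵖ E] (π : E → X) (A : InitPath E → SmoothPath E) (ξ₀ : E) : Set G :=
  {g | ∃ γ : SmoothLoop X (π ξ₀), HasHolonomy π A ξ₀ γ g}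

/-! ### The associated bundle -/

section Associated

variable {E G H : Type*} [Group G] [Group H] [MulAction Gᵐᵒᵖ E]

/-- The orbit relation of the right action `(p, h) g = (p g, f(g)⁻¹ h)` of `G` on `E × H`. -/
def assocSetoid (E : Type*) [MulAction Gᵐᵒᵖ E] (f : G →* H) : Setoid (E × H) where
  r a b := ∃ g : G, b = (MulOpposite.op g • a.1, (f g)⁻¹ * a.2)
  iseqv := by
    refine ⟨fun a => ⟨1, by simp⟩, ?_, ?_⟩
    · rintro a _ ⟨g, rfl⟩
      exact ⟨g⁻¹, by simp [← mul_smul]⟩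
    · rintro a _ _ ⟨g, rfl⟩ ⟨g', rfl⟩
      exact ⟨g * g', by simp [mul_smul, mul_assoc]⟩

/-- The associated bundle `E ×_f H`. It carries the quotient diffeology. -/
abbrev Assoc (E : Type*) [MulAction Gᵐᵒᵖ E] (f : G →* H) : Type _ := Quotient (assocSetoid E f)

/-- The class `⟦p, h⟧`. -/
def Assoc.mk (f : G →* H) (p : E) (h : H) : Assoc E f := Quotient.mk (assocSetoid E f) (p, h)

theorem Assoc.mk_smul (f : G →* H) (p : E) (g : G) (h : H) :
    Assoc.mk f (MulOpposite.op g • p) ((f g)⁻¹ * h) = Assoc.mk f p h :=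
  (Quotient.sound (s := assocSetoid E f) (a := (p, h)) ⟨g, rfl⟩).symm

/-- The projection `⟦p, h⟧ ↦ π p` of the associated bundle. -/
def Assoc.proj {X : Type*} (f : G →* H) (π : E → X)
    (hπ : ∀ p (g : G), π (MulOpposite.op g • p) = π p) : Assoc E f → X :=
  Quotient.lift (fun a => π a.1) (by rintro a _ ⟨g, rfl⟩; exact (hπ _ _).symm)

/-- The map `⟦p, h⟧ ↦ ⟦T p, h⟧` induced by an equivariant map `T`. -/
def Assoc.map (f : G →* H) (T : E → E)
    (hT : ∀ p (g : G), T (MulOpposite.op g • p) = MulOpposite.op g • T p) :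
    Assoc E f → Assoc E f :=
  Quotient.map (fun a => (T a.1, a.2)) (by rintro a _ ⟨g, rfl⟩; exact ⟨g, by simp [hT]⟩)

/-- The right action `⟦p, h⟧ k = ⟦p, h k⟧` of `H` on the associated bundle. -/
instance instAssocAction (f : G →* H) : MulAction Hᵐᵒᵖ (Assoc E f) where
  smul k := Quotient.map (fun a => (a.1, a.2 * k.unop)) (by
    rintro a _ ⟨g, rfl⟩; exact ⟨g, by simp [mul_assoc]⟩)
  one_smul := by
    rintro ⟨a⟩
    exact congrArg (Quotient.mk _) (by simp)
  mul_smul := by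
    rintro k l ⟨a⟩
    exact congrArg (Quotient.mk _) (by simp [mul_assoc])

instance instAssocSmooth [DiffeologicalSpace E] [DiffeologicalSpace H] [DiffeologicalGroup H]
    (f : G →* H) : SmoothRightAction H (Assoc E f) where
  smooth_act := by
    intro n p hp x
    obtain ⟨q, hq, h⟩ := hp.1 x
    refine ⟨fun y => ((q y).1, (q y).2 * (p y).2), ⟨hq.1, ?_⟩, ?_⟩
    · exact (DiffeologicalGroup.smooth_mul (G := H)) n (fun y => ((q y).2, (p y).2)) ⟨hq.2, hp.2⟩
    · filter_upwards [h] with y hy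
      simp only [Function.comp, hy]
      rfl

end Associated

/-! ### Retrace classes of paths on the unit interval -/

section PathClasses

/-- The space `C^∞([0,1], X)` with the functional diffeology. -/
abbrev IPath (X : Type*) [DiffeologicalSpace X] : Type _ := SmoothMap I X

/-- A smooth map `ℝ → [0,1]` which is `0` for `t ≤ 1/3` and `1` for `t ≥ 2/3`. -/
def flat (t : ℝ) : I :=
  ⟨Real.smoothTransition (3 * t - 1), Real.smoothTransition.nonneg _, Real.smoothTransition.le_one _⟩

theorem flat_smooth : DSmooth flat := by
  intro n p hp
  have h : ContDiff ℝ ∞ p := hp.contDiff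
  exact ContDiff.isPlot (p := fun x => Real.smoothTransition (3 * p x - 1))
    (Real.smoothTransition.contDiff.comp ((contDiff_const.mul h).sub contDiff_const))

theorem flat_zero {t : ℝ} (ht : t ≤ 1 / 3) : flat t = 0 :=
  Subtype.ext (Real.smoothTransition.zero_of_nonpos (by linarith))

theorem flat_one {t : ℝ} (ht : 2 / 3 ≤ t) : flat t = 1 :=
  Subtype.ext (Real.smoothTransition.one_of_one_le (by linarith))

/-- The underlying map of the concatenation `β ∨ α`, "`β` after `α`". -/
def concatFun {X : Type*} (β α : I → X) (t : ℝ) : X :=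
  if t < 1 / 2 then α (flat (2 * t)) else β (flat (2 * t - 1))

theorem concatFun_left {X : Type*} {β α : I → X} (h : α 1 = β 0) {t : ℝ} (ht : t ≤ 2 / 3) :
    concatFun β α t = α (flat (2 * t)) := by
  unfold concatFun
  split_ifs with h'
  · rfl
  · rw [flat_zero (by linarith), flat_one (by linarith), h]

theorem concatFun_right {X : Type*} {β α : I → X} (h : α 1 = β 0) {t : ℝ} (ht : 1 / 3 ≤ t) :
    concatFun β α t = β (flat (2 * t - 1)) := by
  unfold concatFun
  split_ifs with h'
  · rw [flat_zero (t := 2 * t - 1) (by linarith), flat_one (t := 2 * t) (by linarith), h]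
  · rfl

variable {X : Type*} [DiffeologicalSpace X]

/-- Concatenation depends smoothly on all of its arguments. -/
theorem concatFun_isPlot {n : ℕ} {β α : Euc n → IPath X} (hβ : IsPlot β) (hα : IsPlot α)
    (h : ∀ r, α r 1 = β r 0) {t : Euc n → ℝ} (ht : IsPlot t) :
    IsPlot fun r => concatFun (β r) (α r) (t r) := by
  have htc : ContDiff ℝ ∞ t := ht.contDiff
  refine DiffeologicalSpace.locality fun x => ?_
  rcases lt_or_ge (t x) (1 / 2) with hx | hx
  · refine ⟨t ⁻¹' Set.Iio (2 / 3), isOpen_Iio.preimage htc.continuous,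
      by simp only [Set.mem_preimage, Set.mem_Iio]; linarith, ?_⟩
    intro m f hfu hf
    have e : (fun r => concatFun (β r) (α r) (t r)) ∘ f =
        fun r => α (f r) (flat (2 * t (f r))) := by
      funext r
      exact concatFun_left (h _) (le_of_lt (hfu r))
    rw [e]
    exact hα m (fun r => (f r, flat (2 * t (f r))))
      ⟨hf.isPlot, (ContDiff.isPlot (p := fun r => 2 * t (f r))
        (contDiff_const.mul (htc.comp hf))).dSmooth_comp flat_smooth⟩
  · refine ⟨t ⁻¹' Set.Ioi (1 / 3), isOpen_Ioi.preimage htc.continuous,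
      by simp only [Set.mem_preimage, Set.mem_Ioi]; linarith, ?_⟩
    intro m f hfu hf
    have e : (fun r => concatFun (β r) (α r) (t r)) ∘ f =
        fun r => β (f r) (flat (2 * t (f r) - 1)) := by
      funext r
      exact concatFun_right (h _) (le_of_lt (hfu r))
    rw [e]
    exact hβ m (fun r => (f r, flat (2 * t (f r) - 1)))
      ⟨hf.isPlot, (ContDiff.isPlot (p := fun r => 2 * t (f r) - 1)
        ((contDiff_const.mul (htc.comp hf)).sub contDiff_const)).dSmooth_comp flat_smooth⟩

/-- The concatenation `β ∨ α`, "`β` after `α`", of two smooth paths with `α(1) = β(0)`. It runs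
through `α` on `[0,1/2]` and through `β` on `[1/2,1]`, both of them first made constant near
their endpoints by reparametrization, so that the result is smooth. -/
def IPath.concat (β α : IPath X) (h : α 1 = β 0) : IPath X where
  toFun t := concatFun β α t
  smooth _ p hp := concatFun_isPlot (β := fun _ => β) (α := fun _ => α) isPlot_const isPlot_const
    (fun _ => h) (t := fun x => (p x).1) hp

/-- The reversed path `t ↦ η(1 - t)`. -/
def IPath.rev (η : IPath X) : IPath X where
  toFun t := η (unitInterval.symm t)
  smooth := by
    refine η.smooth.comp ?_
    intro n p hp
    exact ContDiff.isPlot (p := fun x => 1 - (p x).1)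
      (contDiff_const.sub (IsPlot.contDiff (p := fun x => (p x).1) hp))

/-- The constant path. -/
def IPath.const (x : X) : IPath X := ⟨fun _ => x, dSmooth_const⟩

theorem IPath.concat_zero (β α : IPath X) (h : α 1 = β 0) : β.concat α h 0 = α 0 := by
  change concatFun _ _ ((0 : I) : ℝ) = _
  rw [concatFun_left h (by norm_num), flat_zero (by simp)]

theorem IPath.concat_one (β α : IPath X) (h : α 1 = β 0) : β.concat α h 1 = β 1 := by
  change concatFun _ _ ((1 : I) : ℝ) = _
  rw [concatFun_right h (by norm_num), flat_one (by norm_num)]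

theorem IPath.rev_zero (η : IPath X) : η.rev 0 = η 1 := by
  change η _ = _
  simp

theorem IPath.rev_one (η : IPath X) : η.rev 1 = η 0 := by
  change η _ = _
  simp

/-- Retrace equivalence: the smallest equivalence relation on `C^∞([0,1], X)`, compatible with
concatenation, which identifies
* `α ∘ f` with `α`, for every smooth `f : [0,1] → [0,1]` with `f(0) = 0` and `f(1) = 1`, and
* `β ∨ η ∨ η^← ∨ α` with `β ∨ α`, where `η^←(t) = η(1 - t)`.

The maps `f` are not required to be diffeomorphisms: making a path constant near its endpoints, as
is needed to concatenate smoothly, is itself such a reparametrization. -/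
inductive Retrace : IPath X → IPath X → Prop
  | reparam (α : IPath X) (f : SmoothMap I I) (h₀ : f 0 = 0) (h₁ : f 1 = 1) :
      Retrace (α.comp f) α
  | retrace (β η α : IPath X) (h : α 1 = η 1) (h' : η 1 = β 0) :
      Retrace
        (β.concat (η.concat (η.rev.concat α (h.trans η.rev_zero.symm))
          ((IPath.concat_one _ _ _).trans η.rev_one)) ((IPath.concat_one _ _ _).trans h'))
        (β.concat α (h.trans h'))
  | concat {β β' α α' : IPath X} (h : α 1 = β 0) (h' : α' 1 = β' 0) :
      Retrace β β' → Retrace α α' → Retrace (β.concat α h) (β'.concat α' h')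
  | refl (α : IPath X) : Retrace α α
  | symm {α β : IPath X} : Retrace α β → Retrace β α
  | trans {α β γ : IPath X} : Retrace α β → Retrace β γ → Retrace α γ

theorem Retrace.endpoints {α β : IPath X} (h : Retrace α β) : α 0 = β 0 ∧ α 1 = β 1 := by
  induction h with
  | reparam α f h₀ h₁ => exact ⟨congrArg α.toFun h₀, congrArg α.toFun h₁⟩
  | retrace β η α h h' => simp [IPath.concat_zero, IPath.concat_one]
  | concat h h' _ _ ih₁ ih₂ => simp [IPath.concat_zero, IPath.concat_one, ih₁, ih₂]
  | refl => simp
  | symm _ ih => exact ⟨ih.1.symm, ih.2.symm⟩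
  | trans _ _ ih₁ ih₂ => exact ⟨ih₁.1.trans ih₂.1, ih₁.2.trans ih₂.2⟩

/-- Retrace equivalence as a setoid. -/
def retraceSetoid (X : Type*) [DiffeologicalSpace X] : Setoid (IPath X) :=
  ⟨Retrace, .refl, .symm, .trans⟩

/-- The space `ℱ(X)` of retrace classes of smooth paths, with the quotient diffeology. -/
abbrev PathClass (X : Type*) [DiffeologicalSpace X] : Type _ := Quotient (retraceSetoid X)

/-- The class `[α]`. -/
def PathClass.mk (α : IPath X) : PathClass X := Quotient.mk (retraceSetoid X) α

/-- The initial point of a class of paths. -/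
def PathClass.source : PathClass X → X :=
  Quotient.lift (fun α => α 0) fun _ _ h => (Retrace.endpoints h).1

/-- The final point of a class of paths. -/
def PathClass.target : PathClass X → X :=
  Quotient.lift (fun α => α 1) fun _ _ h => (Retrace.endpoints h).2

open Classical in
/-- The concatenation `[β] ∨ [α] = [β ∨ α]` of classes with `α(1) = β(0)`. (Its value is `[α]`
if this condition fails.) -/
def PathClass.concat (b a : PathClass X) : PathClass X :=
  Quotient.map₂ (sc := retraceSetoid X)
    (fun β α => if h : α 1 = β 0 then IPath.concat β α h else α) (by
    intro β β' hβ α α' hα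
    have e : α 1 = β 0 ↔ α' 1 = β' 0 := by
      rw [(Retrace.endpoints hα).2, (Retrace.endpoints hβ).1]
    by_cases h : α 1 = β 0
    · rw [dif_pos h, dif_pos (e.mp h)]
      exact Retrace.concat h (e.mp h) hβ hα
    · rw [dif_neg h, dif_neg fun h' => h (e.mpr h')]
      exact hα) b a

theorem PathClass.concat_mk (β α : IPath X) (h : α 1 = β 0) :
    (mk β).concat (mk α) = mk (β.concat α h) :=
  congrArg (Quotient.mk (retraceSetoid X)) (dif_pos h)

theorem PathClass.concat_of_ne {b a : PathClass X} (h : a.target ≠ b.source) :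
    b.concat a = a := by
  induction b using Quotient.inductionOn with | _ β =>
  induction a using Quotient.inductionOn with | _ α =>
  exact congrArg (Quotient.mk (retraceSetoid X)) (dif_neg h)

theorem PathClass.source_concat (b a : PathClass X) : (b.concat a).source = a.source := by
  by_cases h : a.target = b.source
  · induction b using Quotient.inductionOn with | _ β =>
    induction a using Quotient.inductionOn with | _ α =>
    exact (congrArg PathClass.source (PathClass.concat_mk β α h)).trans (IPath.concat_zero β α h)
  · rw [PathClass.concat_of_ne h]

theorem PathClass.target_concat {b a : PathClass X} (h : a.target = b.source) :
    (b.concat a).target = b.target := by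
  induction b using Quotient.inductionOn with | _ β =>
  induction a using Quotient.inductionOn with | _ α =>
  exact (congrArg PathClass.target (PathClass.concat_mk β α h)).trans (IPath.concat_one β α h)

/-! ### The groupoid laws for classes of paths -/

/-- Postcomposition is compatible with concatenation. -/
theorem IPath.comp_concat (W : IPath X) (v u : IPath I) (h : u 1 = v 0) :
    W.comp (IPath.concat v u h) =
      IPath.concat (W.comp v) (W.comp u) (congrArg W.toFun h) := by
  apply SmoothMap.ext
  funext t
  exact apply_ite W.toFun _ _ _

theorem mk_reparam (W : IPath X) (f : SmoothMap I I) (h₀ : f 0 = 0) (h₁ : f 1 = 1) :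
    PathClass.mk (W.comp f) = PathClass.mk W := Quotient.sound (Retrace.reparam W f h₀ h₁)

/-- The constant class at `x`. -/
def PathClass.const (x : X) : PathClass X := PathClass.mk (IPath.const x)

theorem PathClass.concat_const {a : PathClass X} {x : X} (h : a.source = x) :
    a.concat (.const x) = a := by
  subst h
  induction a using Quotient.inductionOn with | _ α =>
  refine (PathClass.concat_mk α (IPath.const (α 0)) rfl).trans
    (Eq.trans ?_ (mk_reparam α (IPath.concat ⟨id, dSmooth_id⟩ (IPath.const 0) rfl)
      (IPath.concat_zero _ _ _) (IPath.concat_one _ _ _)))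
  exact congrArg PathClass.mk (IPath.comp_concat α ⟨id, dSmooth_id⟩ (IPath.const 0) rfl).symm

theorem PathClass.const_concat {a : PathClass X} {x : X} (h : a.target = x) :
    (PathClass.const x).concat a = a := by
  subst h
  induction a using Quotient.inductionOn with | _ α =>
  refine (PathClass.concat_mk (IPath.const (α 1)) α rfl).trans
    (Eq.trans ?_ (mk_reparam α (IPath.concat (IPath.const 1) ⟨id, dSmooth_id⟩ rfl)
      (IPath.concat_zero _ _ _) (IPath.concat_one _ _ _)))
  exact congrArg PathClass.mk (IPath.comp_concat α (IPath.const 1) ⟨id, dSmooth_id⟩ rfl).symm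

theorem flat_le_half {t : ℝ} (ht : t ≤ 1 / 2) : (flat t : ℝ) ≤ 1 / 2 := by
  have h := expNegInvGlue.monotone (show 3 * t - 1 ≤ 1 - (3 * t - 1) by linarith)
  have hp := Real.smoothTransition.pos_denom (3 * t - 1)
  change expNegInvGlue (3 * t - 1) / _ ≤ _
  rw [div_le_iff₀ hp]
  linarith

theorem half_le_flat {t : ℝ} (ht : 1 / 2 ≤ t) : 1 / 2 ≤ (flat t : ℝ) := by
  have h := expNegInvGlue.monotone (show 1 - (3 * t - 1) ≤ 3 * t - 1 by linarith)
  have hp := Real.smoothTransition.pos_denom (3 * t - 1)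
  change _ ≤ expNegInvGlue (3 * t - 1) / _
  rw [le_div_iff₀ hp]
  linarith

theorem smooth_coe : DSmooth (fun t : I => (t : ℝ)) := fun _ _ hp => hp

theorem smooth_affine {Y : Type*} [DiffeologicalSpace Y] {g : Y → ℝ} (hg : DSmooth g) (a b : ℝ) :
    DSmooth fun y => a * g y + b := by
  intro n p hp
  exact ContDiff.isPlot (p := fun x => a * g (p x) + b)
    ((contDiff_const.mul (IsPlot.contDiff (p := fun x => g (p x)) (hg n p hp))).add contDiff_const)

/-- The affine path in `[0,1]` from `b` to `a + b`. -/
def affinePath (a b : ℝ) (ha : 0 ≤ a) (hb : 0 ≤ b) (h : a + b ≤ 1) : IPath I where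
  toFun t := ⟨a * t + b, by have := t.2.1; positivity, by nlinarith [t.2.2]⟩
  smooth := smooth_affine smooth_coe a b

/-- The map `flat ∘ g`. -/
def flatComp (g : I → ℝ) (hg : DSmooth g) : SmoothMap I I := ⟨fun t => flat (g t), flat_smooth.comp hg⟩

theorem PathClass.concat_assoc {c b a : PathClass X} (h : a.target = b.source)
    (h' : b.target = c.source) : (c.concat b).concat a = c.concat (b.concat a) := by
  induction c using Quotient.inductionOn with | _ γ =>
  induction b using Quotient.inductionOn with | _ β =>
  induction a using Quotient.inductionOn with | _ α =>
  change α 1 = β 0 at h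
  change β 1 = γ 0 at h'
  have hβα : (IPath.concat β α h) 1 = γ 0 := (IPath.concat_one _ _ _).trans h'
  let W : IPath X := IPath.concat γ (IPath.concat β α h) hβα
  let s₁ : IPath I := affinePath (1 / 4) 0 (by norm_num) (by norm_num) (by norm_num)
  let s₂ : IPath I := affinePath (1 / 4) (1 / 4) (by norm_num) (by norm_num) (by norm_num)
  let s₃ : IPath I := affinePath (1 / 2) (1 / 2) (by norm_num) (by norm_num) (by norm_num)
  have smooth_flat : ∀ u v : ℝ, DSmooth fun t : I => (flat (u * t + v) : ℝ) := fun u v =>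
    smooth_coe.comp (flat_smooth.comp (smooth_affine smooth_coe u v))
  have e₁ : PathClass.mk (W.comp s₁) = PathClass.mk α := by
    rw [← mk_reparam α (flatComp (fun t => 2 * (flat (1 / 2 * t + 0) : ℝ) + 0)
      (smooth_affine (smooth_flat _ _) _ _))
      (by
        change flat (2 * (flat (1 / 2 * ((0 : I) : ℝ) + 0) : ℝ) + 0) = 0
        rw [flat_zero]
        rw [flat_zero] <;> norm_num)
      (by
        change flat _ = 1
        rw [flat_one]
        have := half_le_flat (t := 1 / 2 * ((1 : I) : ℝ) + 0) (by norm_num)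
        linarith)]
    refine congrArg PathClass.mk (SmoothMap.ext (funext fun t => ?_))
    have ht := t.2.2
    change concatFun _ _ (1 / 4 * (t : ℝ) + 0) = α (flat _)
    rw [concatFun_left hβα (by linarith)]
    change concatFun _ _ _ = _
    have h2 : (2 : ℝ) * (1 / 4 * t + 0) = 1 / 2 * t + 0 := by ring
    rw [h2, concatFun_left h (by linarith [flat_le_half (t := 1 / 2 * t + 0) (by linarith)])]
    exact congrArg (fun z => α (flat z)) (add_zero _).symm
  have e₂ : PathClass.mk (W.comp s₂) = PathClass.mk β := by
    rw [← mk_reparam β (flatComp (fun t => 2 * (flat (1 / 2 * t + 1 / 2) : ℝ) + (-1))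
      (smooth_affine (smooth_flat _ _) _ _))
      (by
        change flat _ = 0
        rw [flat_zero]
        have := flat_le_half (t := 1 / 2 * ((0 : I) : ℝ) + 1 / 2) (by norm_num)
        linarith)
      (by
        change flat (2 * (flat (1 / 2 * ((1 : I) : ℝ) + 1 / 2) : ℝ) + (-1)) = 1
        rw [flat_one]
        rw [flat_one] <;> norm_num)]
    refine congrArg PathClass.mk (SmoothMap.ext (funext fun t => ?_))
    have ht := t.2.2
    have ht' := t.2.1
    change concatFun _ _ (1 / 4 * (t : ℝ) + 1 / 4) = β (flat _)
    rw [concatFun_left hβα (by linarith)]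
    change concatFun _ _ _ = _
    have h2 : (2 : ℝ) * (1 / 4 * t + 1 / 4) = 1 / 2 * t + 1 / 2 := by ring
    rw [h2, concatFun_right h (by linarith [half_le_flat (t := 1 / 2 * t + 1 / 2) (by linarith)]),
      sub_eq_add_neg]
  have e₃ : PathClass.mk (W.comp s₃) = PathClass.mk γ := by
    rw [← mk_reparam γ (flatComp (fun t => 1 * (t : ℝ) + 0) (smooth_affine smooth_coe _ _))
      (by change flat _ = 0; rw [flat_zero]; norm_num)
      (by change flat _ = 1; rw [flat_one]; norm_num)]
    refine congrArg PathClass.mk (SmoothMap.ext (funext fun t => ?_))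
    have ht' := t.2.1
    change concatFun _ _ (1 / 2 * (t : ℝ) + 1 / 2) = γ (flat _)
    rw [concatFun_right hβα (by linarith)]
    congr 2
    ring
  have j₁ : s₁ 1 = s₂ 0 := Subtype.ext (by
    change 1 / 4 * ((1 : I) : ℝ) + 0 = 1 / 4 * ((0 : I) : ℝ) + 1 / 4
    norm_num)
  have j₂ : s₂ 1 = s₃ 0 := Subtype.ext (by
    change 1 / 4 * ((1 : I) : ℝ) + 1 / 4 = 1 / 2 * ((0 : I) : ℝ) + 1 / 2
    norm_num)
  have j₀ : s₁ 0 = 0 := Subtype.ext (by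
    change 1 / 4 * ((0 : I) : ℝ) + 0 = 0
    norm_num)
  have j₃ : s₃ 1 = 1 := Subtype.ext (by
    change 1 / 2 * ((1 : I) : ℝ) + 1 / 2 = 1
    norm_num)
  have j : s₁ 1 = (IPath.concat s₃ s₂ j₂) 0 := j₁.trans (IPath.concat_zero _ _ _).symm
  have k₂ : (W.comp s₂) 1 = (W.comp s₃) 0 := congrArg W.toFun j₂
  have k : (W.comp s₁) 1 = (IPath.concat (W.comp s₃) (W.comp s₂) k₂) 0 :=
    (congrArg W.toFun j₁).trans
      (IPath.concat_zero (W.comp s₃) (W.comp s₂) k₂).symm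
  change ((PathClass.mk γ).concat (PathClass.mk β)).concat (PathClass.mk α) =
    (PathClass.mk γ).concat ((PathClass.mk β).concat (PathClass.mk α))
  rw [PathClass.concat_mk β α h, PathClass.concat_mk γ _ hβα]
  conv_lhs => rw [← e₁, ← e₂, ← e₃]
  rw [PathClass.concat_mk _ _ k₂, PathClass.concat_mk _ _ k]
  refine Eq.trans ?_ (mk_reparam W (IPath.concat (IPath.concat s₃ s₂ j₂) s₁ j)
    ((IPath.concat_zero _ _ _).trans j₀)
    ((IPath.concat_one _ _ _).trans ((IPath.concat_one _ _ _).trans j₃)))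
  refine congrArg PathClass.mk ?_
  rw [IPath.comp_concat]
  congr 1
  rw [IPath.comp_concat]

theorem PathClass.concat_rev_mk (η : IPath X) :
    (PathClass.mk η).concat (PathClass.mk η.rev) = PathClass.const (η 1) := by
  have hc : (IPath.const (η 1)) 1 = η 1 := rfl
  have hc' : η 1 = (IPath.const (η 1)) 0 := rfl
  have h := Quotient.sound (s := retraceSetoid X)
    (Retrace.retrace (IPath.const (η 1)) η (IPath.const (η 1)) hc hc')
  change PathClass.mk _ = PathClass.mk _ at h
  rw [← PathClass.concat_mk, ← PathClass.concat_mk, ← PathClass.concat_mk, ← PathClass.concat_mk] at h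
  change (PathClass.const (η 1)).concat ((PathClass.mk η).concat ((PathClass.mk η.rev).concat
    (PathClass.const (η 1)))) = (PathClass.const (η 1)).concat (PathClass.const (η 1)) at h
  rw [PathClass.concat_const (a := PathClass.mk η.rev) η.rev_zero,
    PathClass.const_concat (a := PathClass.const (η 1)) (x := η 1) rfl] at h
  rw [← h, PathClass.const_concat]
  exact PathClass.target_concat (b := PathClass.mk η) (a := PathClass.mk η.rev) η.rev_one

theorem IPath.rev_rev (η : IPath X) : η.rev.rev = η :=
  SmoothMap.ext (funext fun t => congrArg η.toFun (unitInterval.symm_symm t))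

theorem PathClass.rev_concat_mk (η : IPath X) :
    (PathClass.mk η.rev).concat (PathClass.mk η) = PathClass.const (η 0) := by
  have h := PathClass.concat_rev_mk η.rev
  rwa [IPath.rev_rev, IPath.rev_one] at h

/-- The reversed class `[α^←]`. -/
def PathClass.rev : PathClass X → PathClass X :=
  Quotient.map IPath.rev (by
    intro α β hαβ
    have e : PathClass.mk α = PathClass.mk β := Quotient.sound hαβ
    obtain ⟨h₀, h₁⟩ := Retrace.endpoints hαβ
    refine Quotient.exact (s := retraceSetoid X)
      (show PathClass.mk α.rev = PathClass.mk β.rev from ?_)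
    have h := PathClass.concat_assoc (c := PathClass.mk α.rev) (b := PathClass.mk α)
      (a := PathClass.mk β.rev) (β.rev_one.trans h₀.symm) α.rev_zero.symm
    rw [PathClass.rev_concat_mk, e, PathClass.concat_rev_mk, PathClass.const_concat
      (a := PathClass.mk β.rev) (β.rev_one.trans h₀.symm), PathClass.concat_const
      (a := PathClass.mk α.rev) (α.rev_zero.trans h₁)] at h
    exact h.symm)

/-! ### The loop group and the pointed path bundle -/

/-- The loop group `Ω_{x₀}(X)`, with the subspace diffeology from `ℱ(X)`. -/
def LoopGroup (X : Type*) [DiffeologicalSpace X] (x₀ : X) : Type _ :=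
  {a : PathClass X // a.source = x₀ ∧ a.target = x₀}

instance (x₀ : X) : DiffeologicalSpace (LoopGroup X x₀) :=
  instSubtype fun a : PathClass X => a.source = x₀ ∧ a.target = x₀

/-- The group structure of the loop space: `[γ] [σ] = [γ ∨ σ]` and `[γ]⁻¹ = [γ^←]`. -/
instance instLoopGroup (x₀ : X) : Group (LoopGroup X x₀) where
  mul c b := ⟨c.1.concat b.1, (PathClass.source_concat _ _).trans b.2.1,
    (PathClass.target_concat (b.2.2.trans c.2.1.symm)).trans c.2.2⟩
  one := ⟨PathClass.const x₀, rfl, rfl⟩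
  inv c := ⟨c.1.rev, by
    obtain ⟨c, h₀, h₁⟩ := c
    induction c using Quotient.inductionOn with | _ γ =>
    exact ⟨γ.rev_zero.trans h₁, γ.rev_one.trans h₀⟩⟩
  mul_assoc c b a := Subtype.ext
    (PathClass.concat_assoc (a.2.2.trans b.2.1.symm) (b.2.2.trans c.2.1.symm))
  one_mul a := Subtype.ext (PathClass.const_concat a.2.2)
  mul_one a := Subtype.ext (PathClass.concat_const a.2.1)
  inv_mul_cancel := by
    rintro ⟨c, h₀, h₁⟩
    induction c using Quotient.inductionOn with | _ γ =>
    exact Subtype.ext ((PathClass.rev_concat_mk γ).trans (congrArg PathClass.const h₀))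

/-- The space `ℱ_{x₀}(X)` of classes of paths starting at `x₀`, with the subspace diffeology from
`ℱ(X)`. -/
def PointedPaths (X : Type*) [DiffeologicalSpace X] (x₀ : X) : Type _ :=
  {a : PathClass X // a.source = x₀}

instance (x₀ : X) : DiffeologicalSpace (PointedPaths X x₀) :=
  instSubtype fun a : PathClass X => a.source = x₀

/-- The target map `τ([α]) = α(1)`. -/
def PointedPaths.target {x₀ : X} (a : PointedPaths X x₀) : X := a.1.target

theorem PointedPaths.smooth_target {x₀ : X} :
    DSmooth (PointedPaths.target : PointedPaths X x₀ → X) := by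
  intro n p hp
  refine DiffeologicalSpace.locality fun x => ?_
  obtain ⟨q, hq, h⟩ := hp x
  obtain ⟨u, hu, ho, hx⟩ := eventually_nhds_iff.mp h
  refine ⟨u, ho, hx, fun {m f} hfu hf => ?_⟩
  have e : (PointedPaths.target ∘ p) ∘ f = fun y => q (f y) 1 := by
    funext y
    exact congrArg PathClass.target (hu _ (hfu y))
  rw [e]
  exact hq m (fun y => (f y, 1)) ⟨hf.isPlot, isPlot_const⟩

/-- The right action `[α] · [γ] = [α ∨ γ]` of the loop group on `ℱ_{x₀}(X)`. -/
instance instPointedAction (x₀ : X) : MulAction (LoopGroup X x₀)ᵐᵒᵖ (PointedPaths X x₀) where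
  smul g a := ⟨a.1.concat g.unop.1, (PathClass.source_concat _ _).trans g.unop.2.1⟩
  one_smul a := Subtype.ext (PathClass.concat_const a.2)
  mul_smul g k a := Subtype.ext (PathClass.concat_assoc (g.unop.2.2.trans k.unop.2.1.symm)
    (k.unop.2.2.trans a.2.symm)).symm

theorem PointedPaths.target_smul {x₀ : X} (a : PointedPaths X x₀) (g : LoopGroup X x₀) :
    (MulOpposite.op g • a).target = a.target :=
  PathClass.target_concat (g.2.2.trans a.2.symm)

/-! ### The universal connection -/

/-- The path `α^{r → s} : [0,1] → X`, `t ↦ α(t s + (1 - t) r)`. -/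
def SmoothPath.segment (α : SmoothPath X) (r s : α.dom) : IPath X where
  toFun t := α ⟨t * s.1 + (1 - t) * r.1, by
    have h := α.ordConnected_dom.convex r.2 s.2 (sub_nonneg.mpr t.2.2) t.2.1 (by ring)
    simpa [add_comm] using h⟩
  smooth n p hp := α.smooth n (fun x => ⟨(p x).1 * s.1 + (1 - (p x).1) * r.1, _⟩)
    (ContDiff.isPlot (p := fun x => (p x).1 * s.1 + (1 - (p x).1) * r.1)
      (((IsPlot.contDiff (p := fun x => (p x).1) hp).mul contDiff_const).add
        ((contDiff_const.sub (IsPlot.contDiff (p := fun x => (p x).1) hp)).mul contDiff_const)))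

theorem SmoothPath.segment_zero (α : SmoothPath X) (r s : α.dom) : α.segment r s 0 = α r :=
  congrArg α.toFun (Subtype.ext (by simp))

theorem SmoothPath.segment_one (α : SmoothPath X) (r s : α.dom) : α.segment r s 1 = α s :=
  congrArg α.toFun (Subtype.ext (by simp))

/-- Transport along `α` from time `r` to time `s` in the pointed path bundle:
`[β] ↦ [α^{r → s} ∨ β]`, for `[β]` in the fibre over `α r`. -/
def transport {x₀ : X} (α : SmoothPath X) (r s : α.dom) (a : PointedPaths X x₀) :
    PointedPaths X x₀ :=
  ⟨(PathClass.mk (α.segment r s)).concat a.1, (PathClass.source_concat _ _).trans a.2⟩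

theorem transport_smul {x₀ : X} (α : SmoothPath X) (r s : α.dom) (a : PointedPaths X x₀)
    (g : LoopGroup X x₀) :
    transport α r s (MulOpposite.op g • a) = MulOpposite.op g • transport α r s a := by
  have hg : g.1.target = a.1.source := g.2.2.trans a.2.symm
  apply Subtype.ext
  change (PathClass.mk _).concat (a.1.concat g.1) = ((PathClass.mk _).concat a.1).concat g.1
  by_cases h : a.1.target = (PathClass.mk (α.segment r s)).source
  · exact (PathClass.concat_assoc hg h).symm
  · rw [PathClass.concat_of_ne h, PathClass.concat_of_ne]
    rwa [PathClass.target_concat hg]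

theorem smooth_transport {x₀ : X} (α : SmoothPath X) (r : α.dom) (a : PointedPaths X x₀) :
    DSmooth fun s => transport α r s a := by
  intro n p hp
  obtain ⟨c, hc⟩ := a
  induction c using Quotient.inductionOn with | _ A =>
  by_cases h : A 1 = α r
  · have h' : ∀ s, A 1 = α.segment r s 0 := fun s => h.trans (α.segment_zero r s).symm
    intro x
    refine ⟨fun y => IPath.concat (α.segment r (p y)) A (h' _), ?_, Filter.Eventually.of_forall
      fun y => PathClass.concat_mk _ _ (h' _)⟩
    intro m q hq
    have hs : IsPlot fun y => α.segment r (p (q y).1) := by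
      intro k w hw
      refine α.smooth k (fun z => ⟨(w z).2.1 * (p (q (w z).1).1).1 + (1 - (w z).2.1) * r.1, _⟩) ?_
      have c₁ : ContDiff ℝ ∞ fun z => (w z).2.1 := IsPlot.contDiff (p := fun z => (w z).2.1) hw.2
      have c₂ : ContDiff ℝ ∞ fun z => (p (q (w z).1).1).1 := IsPlot.contDiff
        (p := fun z => (p (q (w z).1).1).1)
        (isPlot_reparam hp ((IsPlot.contDiff hq.1).comp (IsPlot.contDiff hw.1)))
      exact ContDiff.isPlot (p := fun z => (w z).2.1 * (p (q (w z).1).1).1 + (1 - (w z).2.1) * r.1)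
        ((c₁.mul c₂).add ((contDiff_const.sub c₁).mul contDiff_const))
    exact concatFun_isPlot (α := fun _ => A) hs isPlot_const (fun _ => h' _)
      (t := fun y => (q y).2.1) hq.2
  · have e : ((fun s => transport α r s ⟨Quotient.mk _ A, hc⟩) ∘ p) =
        fun _ => (⟨Quotient.mk _ A, hc⟩ : PointedPaths X x₀) := by
      funext y
      have hy : A 1 ≠ α.segment r (p y) 0 := fun h' => h (h'.trans (α.segment_zero r (p y)))
      exact Subtype.ext (PathClass.concat_of_ne (a := PathClass.mk A)
        (b := PathClass.mk (α.segment r (p y))) hy)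
    rw [e]
    exact isPlot_const

/-- The universal connection `Θ_r α (s) = [(τ ∘ α)^{r → s}] ∨ α(r)` on the pointed path bundle
`τ : ℱ_{x₀}(X) → X`. -/
def universalConnection {x₀ : X} (p : InitPath (PointedPaths X x₀)) :
    SmoothPath (PointedPaths X x₀) where
  dom := p.path.dom
  isOpen_dom := p.path.isOpen_dom
  ordConnected_dom := p.path.ordConnected_dom
  nonempty_dom := p.path.nonempty_dom
  toFun s := transport (p.path.map _ PointedPaths.smooth_target) p.time s (p.path p.time)
  smooth := smooth_transport (p.path.map _ PointedPaths.smooth_target) p.time (p.path p.time)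

section Induced

variable {G : Type*} [Group G] {x₀ : X} (H : LoopGroup X x₀ →* G)

/-- The total space `ℱ_{x₀}(X) ×_H G`. -/
abbrev HolBundle : Type _ := Assoc (PointedPaths X x₀) H

/-- The projection `τ_H(⟦[α], g⟧) = α(1)`. -/
def HolBundle.proj : HolBundle H → X := Assoc.proj H PointedPaths.target PointedPaths.target_smul

/-- The point `⟦•, e⟧`, where `•` stands for the class of the constant path at the base point. -/
def HolBundle.basepoint : HolBundle H := Assoc.mk H ⟨PathClass.const x₀, rfl⟩ 1

variable [DiffeologicalSpace G]

theorem HolBundle.smooth_proj : DSmooth (HolBundle.proj H) := by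
  intro n p hp
  refine DiffeologicalSpace.locality fun x => ?_
  obtain ⟨q, hq, h⟩ := hp x
  obtain ⟨u, hu, ho, hx⟩ := eventually_nhds_iff.mp h
  refine ⟨u, ho, hx, fun {m f} hfu hf => ?_⟩
  have e : (HolBundle.proj H ∘ p) ∘ f = fun y => (q (f y)).1.target := by
    funext y
    exact congrArg (HolBundle.proj H) (hu _ (hfu y))
  rw [e]
  exact (isPlot_reparam hq.1 hf).dSmooth_comp PointedPaths.smooth_target

/-- The connection `Θ^H` induced by the universal connection:
`Θ^H_r ξ (s) = ⟦[(τ_H ∘ ξ)^{r → s}] ∨ [β], g⟧`, where `ξ(r) = ⟦[β], g⟧`. -/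
def inducedConnection (p : InitPath (HolBundle H)) : SmoothPath (HolBundle H) where
  dom := p.path.dom
  isOpen_dom := p.path.isOpen_dom
  ordConnected_dom := p.path.ordConnected_dom
  nonempty_dom := p.path.nonempty_dom
  toFun s := Assoc.map H (transport (p.path.map _ (HolBundle.smooth_proj H)) p.time s)
    (transport_smul _ _ _) (p.path p.time)
  smooth := by
    intro n q hq
    generalize p.path p.time = ξ
    induction ξ using Quotient.inductionOn with | _ a =>
    exact fun x => ⟨fun y => (transport (p.path.map _ (HolBundle.smooth_proj H)) p.time (q y) a.1,
      a.2), ⟨smooth_transport (p.path.map _ (HolBundle.smooth_proj H)) p.time a.1 n q hq, isPlot_const⟩, Filter.Eventually.of_forall fun _ => rfl⟩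

/-- The path `s ↦ ⟦α(s), ρ(s)⟧` in the associated bundle. -/
def HolBundle.mkPath (α : SmoothPath (PointedPaths X x₀)) (ρ : α.dom → G) (hρ : DSmooth ρ) :
    SmoothPath (HolBundle H) where
  dom := α.dom
  isOpen_dom := α.isOpen_dom
  ordConnected_dom := α.ordConnected_dom
  nonempty_dom := α.nonempty_dom
  toFun s := Assoc.mk H (α s) (ρ s)
  smooth := fun _ p hp _ => ⟨fun y => (α (p y), ρ (p y)),
    ⟨hp.dSmooth_comp α.smooth, hp.dSmooth_comp hρ⟩, Filter.Eventually.of_forall fun _ => rfl⟩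

/-- `Θ^H_r ⟦α, ρ⟧ (s) = ⟦Θ_r α (s), ρ(r)⟧`. -/
theorem inducedConnection_mkPath (α : SmoothPath (PointedPaths X x₀)) (ρ : α.dom → G)
    (hρ : DSmooth ρ) (r s : α.dom) :
    inducedConnection H ((HolBundle.mkPath H α ρ hρ).at r) ⟨s.1, s.2⟩ =
      Assoc.mk H (universalConnection (α.at r) ⟨s.1, s.2⟩) (ρ r) := rfl

end Induced

/-- The class `[γ|[0,1]]` in the loop space of a smooth loop `γ`. -/
def SmoothLoop.toLoopGroup {x₀ : X} (γ : SmoothLoop X x₀) : LoopGroup X x₀ :=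
  ⟨PathClass.mk (γ.segment ⟨0, γ.zero_mem⟩ ⟨1, γ.one_mem⟩),
    (γ.segment_zero _ _).trans γ.map_zero, (γ.segment_one _ _).trans γ.map_one⟩

end PathClasses
end Diffeology
end

noncomputable section

namespace Diffeology

/-! ### Local nature of plots -/

section Plots

variable {Y : Type*} [DiffeologicalSpace Y] {n : ℕ}

/-! The bundle part rests on the groupoid laws for path classes. Two classes `[α]`, `[α']` from the
base point with the same target differ by exactly one loop class, `[α^← ∨ α']`, so the loop group
acts simply transitively on the fibres of the target map. Hence two points `⟦a, g⟧`, `⟦a', g'⟧` of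
one fibre of the associated bundle differ by exactly `g⁻¹ H([a^← ∨ a']) g'`
(`HolBundle.mk_eq_smul_mk`). This expression is smooth in local lifts, which gives the smooth
inverse of the graph map (`HolBundle.isPlot_of_smul`). Plots of `X` lift because `ℝⁿ` is
star-shaped: a path from the base point to `p x` is prolonged along the image of the straight
segment from `x` to `y` (`PointedPaths.exists_local_section`).

The connection transports a point along a path of `X` by concatenating with the class of a segment
of that path. Its axioms follow once these classes compose correctly and behave well under
arbitrary, possibly non-monotone, reparametrizations. Both facts are instances of one statement: the
class of `α ∘ c`, for `c` a path in an interval, depends only on the endpoints of `c` (`mk_comp_eq`,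
`SmoothPath.mk_compIPath_eq`). To see this, prolong `c` to a path in `[0,1]` from `0` to `1`;
composing with it is an admissible reparametrization, so the result does not depend on `c`, and the
prolongations cancel in the groupoid.

A horizontal path is determined by transport from any one of its values, so holonomies are unique.
Transport along a loop `γ` takes `⟦•, e⟧` to `⟦• · [γ], e⟧ = ⟦•, H([γ])⟧`
(`HolBundle.transport_loop`), so the holonomy is `H([γ])`. Every loop class is realized by a smooth
loop, which identifies the holonomy group with the image of `H`. -/

theorem isPlot_of_eventuallyEq {p : Euc n → Y}
    (h : ∀ x, ∃ q : Euc n → Y, IsPlot q ∧ ∀ᶠ y in 𝓝 x, p y = q y) : IsPlot p := by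
  refine DiffeologicalSpace.locality fun x => ?_
  obtain ⟨q, hq, he⟩ := h x
  obtain ⟨u, hu, ho, hx⟩ := eventually_nhds_iff.mp he
  refine ⟨u, ho, hx, fun {m f} hfu hf => ?_⟩
  have e : p ∘ f = q ∘ f := funext fun y => hu _ (hfu y)
  rw [e]
  exact isPlot_reparam hq hf

/-- Together with `IsPlot.exists_lift` this replaces a plot of a quotient by one with a lift defined
on all of `ℝⁿ`, so that endpoint conditions on lifts hold at every point and not merely near `x`. -/
theorem isPlot_of_local_reparam {p : Euc n → Y}
    (h : ∀ x, ∃ ρ : Euc n → Euc n, (∀ᶠ y in 𝓝 x, ρ y = y) ∧ IsPlot fun y => p (ρ y)) :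
    IsPlot p := by
  refine isPlot_of_eventuallyEq fun x => ?_
  obtain ⟨ρ, hρ, hp⟩ := h x
  exact ⟨_, hp, hρ.mono fun y hy => by rw [hy]⟩

/-- A plot of a quotient lifts, after a reparametrization which is the identity near a given
point. -/
theorem IsPlot.exists_lift {s : Setoid Y} {p : Euc n → Quotient s} (hp : IsPlot p) (x : Euc n) :
    ∃ ρ : Euc n → Euc n, ContDiff ℝ ∞ ρ ∧ (∀ᶠ y in 𝓝 x, ρ y = y) ∧
      ∃ q : Euc n → Y, IsPlot q ∧ ∀ y, p (ρ y) = Quotient.mk s (q y) := by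
  obtain ⟨q, hq, he⟩ := hp x
  obtain ⟨u, hu, ho, hx⟩ := eventually_nhds_iff.mp he
  obtain ⟨ρ, hρ, hρu, hid⟩ := exists_smooth_shrink ho hx
  exact ⟨ρ, hρ, hid, q ∘ ρ, isPlot_reparam hq hρ, fun y => hu _ (hρu y)⟩

theorem IsPlot.quotient_mk {s : Setoid Y} {q : Euc n → Y} (hq : IsPlot q) :
    IsPlot fun y => Quotient.mk s (q y) :=
  fun _ => ⟨q, hq, Filter.Eventually.of_forall fun _ => rfl⟩

/-- The evaluation map of path spaces is smooth. -/
theorem IsPlot.path_eval {p : Euc n → SmoothPath Y} (hp : IsPlot p) {s : Euc n → ℝ}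
    (hs : ContDiff ℝ ∞ s) (h : ∀ y, s y ∈ (p y).dom) : IsPlot fun y => p y ⟨s y, h y⟩ := by
  refine DiffeologicalSpace.locality fun x => ?_
  obtain ⟨V, W, hVW, hV, hW, hx, hsx, H⟩ := hp x (s x) (h x)
  refine ⟨V ∩ s ⁻¹' W, hV.inter (hW.preimage hs.continuous), ⟨hx, hsx⟩, fun {m f} hfu hf => ?_⟩
  exact H m (fun y => (⟨f y, (hfu y).1⟩, ⟨s (f y), (hfu y).2⟩)) ⟨hf.isPlot, (hs.comp hf).isPlot⟩

end Plots

section PathClasses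

variable {X : Type*} [DiffeologicalSpace X]

/-! ### The path groupoid -/

theorem IsPlot.concat {n : ℕ} {β α : Euc n → IPath X} (hβ : IsPlot β) (hα : IsPlot α)
    (h : ∀ r, α r 1 = β r 0) : IsPlot fun r => (β r).concat (α r) (h r) := by
  intro m q hq
  have hc : ContDiff ℝ ∞ fun z => (q z).1 := IsPlot.contDiff hq.1
  exact concatFun_isPlot (isPlot_reparam hβ hc) (isPlot_reparam hα hc) (fun _ => h _)
    (t := fun y => (q y).2.1) hq.2

theorem IsPlot.rev {n : ℕ} {α : Euc n → IPath X} (hα : IsPlot α) :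
    IsPlot fun r => (α r).rev := by
  intro m q hq
  exact hα m (fun z => ((q z).1, unitInterval.symm (q z).2)) ⟨hq.1,
    ContDiff.isPlot (p := fun z => 1 - (q z).2.1)
      (contDiff_const.sub (IsPlot.contDiff (p := fun z => (q z).2.1) hq.2))⟩

theorem PathClass.source_rev (a : PathClass X) : a.rev.source = a.target := by
  induction a using Quotient.inductionOn with | _ α => exact α.rev_zero

theorem PathClass.target_rev (a : PathClass X) : a.rev.target = a.source := by
  induction a using Quotient.inductionOn with | _ α => exact α.rev_one

theorem PathClass.concat_rev (a : PathClass X) : a.concat a.rev = .const a.target := by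
  induction a using Quotient.inductionOn with | _ α => exact PathClass.concat_rev_mk α

theorem PathClass.rev_concat (a : PathClass X) : a.rev.concat a = .const a.source := by
  induction a using Quotient.inductionOn with | _ α => exact PathClass.rev_concat_mk α

theorem PathClass.rev_concat_cancel {b a : PathClass X} (h : a.target = b.source) :
    b.rev.concat (b.concat a) = a := by
  rw [← PathClass.concat_assoc h b.source_rev.symm, PathClass.rev_concat,
    PathClass.const_concat h]

theorem PathClass.concat_rev_cancel {b a : PathClass X} (h : a.target = b.target) :
    b.concat (b.rev.concat a) = a := by
  rw [← PathClass.concat_assoc (h.trans b.source_rev.symm) b.target_rev, PathClass.concat_rev,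
    PathClass.const_concat h]

theorem PathClass.concat_left_cancel {b a a' : PathClass X} (h : a.target = b.source)
    (h' : a'.target = b.source) (e : b.concat a = b.concat a') : a = a' := by
  rw [← PathClass.rev_concat_cancel h, e, PathClass.rev_concat_cancel h']

theorem PathClass.concat_concat_rev_cancel {b a : PathClass X} (h : a.target = b.source) :
    (b.concat a).concat a.rev = b := by
  rw [PathClass.concat_assoc a.target_rev h, PathClass.concat_rev, PathClass.concat_const h.symm]

theorem PathClass.concat_right_cancel {b b' a : PathClass X} (h : a.target = b.source)
    (h' : a.target = b'.source) (e : b.concat a = b'.concat a) : b = b' := by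
  rw [← PathClass.concat_concat_rev_cancel h, e, PathClass.concat_concat_rev_cancel h']

theorem PathClass.smooth_rev : DSmooth (PathClass.rev : PathClass X → PathClass X) := by
  intro n p hp
  refine isPlot_of_local_reparam fun x => ?_
  obtain ⟨ρ, -, hid, q, hq, e⟩ := IsPlot.exists_lift hp x
  refine ⟨ρ, hid, ?_⟩
  simp only [Function.comp, e]
  exact IsPlot.quotient_mk (IsPlot.rev hq)

/-- Endpoints are invariants of the class, so local representatives of composable classes are again
composable, and concatenation of representatives is smooth. -/
theorem IsPlot.pathClass_concat {n : ℕ} {b a : Euc n → PathClass X} (hb : IsPlot b)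
    (ha : IsPlot a) (h : ∀ r, (a r).target = (b r).source) :
    IsPlot fun r => (b r).concat (a r) := by
  refine isPlot_of_local_reparam fun x => ?_
  obtain ⟨ρ, hρ, hid, β, hβ, eβ⟩ := IsPlot.exists_lift hb x
  -- The two families are lifted one after the other: after `ρ` the lift of `b` is global, so `a ∘
  -- ρ` may be localized again at an arbitrary point.
  refine ⟨ρ, hid, isPlot_of_local_reparam fun x' => ?_⟩
  obtain ⟨κ, hκ, hid', α, hα, eα⟩ := IsPlot.exists_lift (isPlot_reparam ha hρ) x'
  refine ⟨κ, hid', ?_⟩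
  have hαβ : ∀ r, α r 1 = β (κ r) 0 := fun r => by
    have := h (ρ (κ r))
    rw [eβ] at this
    exact (congrArg PathClass.target (eα r)).symm.trans this
  have e : (fun r => (b (ρ (κ r))).concat (a (ρ (κ r)))) =
      fun r => PathClass.mk ((β (κ r)).concat (α r) (hαβ r)) := by
    funext r
    rw [eβ, show a (ρ (κ r)) = _ from eα r]
    exact PathClass.concat_mk _ _ (hαβ r)
  rw [e]
  exact IsPlot.quotient_mk (IsPlot.concat (isPlot_reparam hβ hκ) hα hαβ)

/-! ### Paths in an interval -/

/-- The class of `W ∘ c`, for `c` a path in `[0,1]`, depends only on the endpoints of `c`. -/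
theorem mk_comp_eq (W : IPath X) (c c' : SmoothMap I I) (h₀ : c 0 = c' 0) (h₁ : c 1 = c' 1) :
    PathClass.mk (W.comp c) = PathClass.mk (W.comp c') := by
  -- The paths `u` from `0` to `c 0` and `v` from `c 1` to `1` complete any `d` with the endpoints
  -- of `c` to a self-map `v ∨ d ∨ u` of `[0,1]` fixing `0` and `1`. Composing `W` with it does not
  -- change the class of `W`.
  let u : IPath I := affinePath (c 0) 0 (c 0).2.1 le_rfl (by simpa using (c 0).2.2)
  let v : IPath I := affinePath (1 - c 1) (c 1) (by linarith [(c 1).2.2]) (c 1).2.1 (by simp)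
  have u₀ : u 0 = 0 := Subtype.ext (by change (c 0 : ℝ) * ((0 : I) : ℝ) + 0 = 0; simp)
  have u₁ : u 1 = c 0 := Subtype.ext (by change (c 0 : ℝ) * ((1 : I) : ℝ) + 0 = c 0; simp)
  have v₀ : v 0 = c 1 := Subtype.ext (by
    change (1 - c 1 : ℝ) * ((0 : I) : ℝ) + c 1 = c 1; simp)
  have v₁ : v 1 = 1 := Subtype.ext (by change (1 - c 1 : ℝ) * ((1 : I) : ℝ) + c 1 = 1; simp)
  have key : ∀ d : SmoothMap I I, u 1 = d 0 → d 1 = v 0 →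
      (PathClass.mk (W.comp v)).concat ((PathClass.mk (W.comp d)).concat
        (PathClass.mk (W.comp u))) = PathClass.mk W := by
    intro d hd hd'
    have k : (IPath.concat d u hd) 1 = v 0 := (IPath.concat_one _ _ _).trans hd'
    have k₁ : (W.comp u) 1 = (W.comp d) 0 := congrArg W.toFun hd
    have k₂ : (IPath.concat (W.comp d) (W.comp u) k₁) 1 = (W.comp v) 0 :=
      (IPath.concat_one _ _ _).trans (congrArg W.toFun hd')
    rw [PathClass.concat_mk _ _ k₁, PathClass.concat_mk _ _ k₂]
    refine Eq.trans (congrArg PathClass.mk ?_) (mk_reparam W (IPath.concat v (IPath.concat d u hd) k)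
      ((IPath.concat_zero _ _ _).trans ((IPath.concat_zero _ _ _).trans u₀))
      ((IPath.concat_one _ _ _).trans v₁))
    rw [IPath.comp_concat]
    congr 1
    rw [IPath.comp_concat]
  have e := (key c u₁ v₀.symm).trans (key c' (u₁.trans h₀) (h₁.symm.trans v₀.symm)).symm
  have w : ∀ d : SmoothMap I I, u 1 = d 0 →
      (PathClass.mk (W.comp u)).target = (PathClass.mk (W.comp d)).source :=
    fun d hd => congrArg W.toFun hd
  have w' : ∀ d : SmoothMap I I, u 1 = d 0 → d 1 = v 0 →
      ((PathClass.mk (W.comp d)).concat (PathClass.mk (W.comp u))).target =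
        (PathClass.mk (W.comp v)).source :=
    fun d hd hd' => (PathClass.target_concat (w d hd)).trans (congrArg W.toFun hd')
  -- The completions of `c` and `c'` both give `[W]`; the common factors `W ∘ v` and `W ∘ u` are
  -- cancelled.
  exact PathClass.concat_right_cancel (w c u₁) (w c' (u₁.trans h₀))
    (PathClass.concat_left_cancel (w' c u₁ v₀.symm)
      (w' c' (u₁.trans h₀) (h₁.symm.trans v₀.symm)) e)

/-- The image of a path in the domain of `α`. -/
def SmoothPath.compIPath (α : SmoothPath X) (c : IPath α.dom) : IPath X :=
  SmoothMap.comp ⟨α.toFun, α.smooth⟩ c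

/-- The self-map of `[0,1]` that is constant near the endpoints. -/
def flatI : SmoothMap I I := flatComp (fun t => t) smooth_coe

theorem flatI_zero : flatI 0 = 0 := flat_zero (by norm_num)

theorem flatI_one : flatI 1 = 1 := flat_one (by norm_num)

/-- Precomposing with `flat` moves the question from `[0,1]` to the real line, where diffeological
smoothness is ordinary smoothness and gives continuity. -/
theorem DSmooth.continuous_comp_flat {g : I → ℝ} (hg : DSmooth g) :
    Continuous fun t : ℝ => g (flat t) := by
  have h : DSmooth fun t : ℝ => g (flat t) := hg.comp flat_smooth
  exact h.contDiff.continuous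

/-- By compactness both flattened paths attain their extrema, which therefore lie in the domain.
This puts them in one compact interval that can be rescaled to `[0,1]`. -/
theorem SmoothPath.exists_bounds (α : SmoothPath X) (c c' : IPath α.dom) :
    ∃ m M : ℝ, m < M ∧ m ∈ α.dom ∧ M ∈ α.dom ∧
      (∀ t, (c (flatI t) : ℝ) ∈ Set.Icc m M) ∧ ∀ t, (c' (flatI t) : ℝ) ∈ Set.Icc m M := by
  have aux : ∀ c : IPath α.dom, ∃ a ∈ α.dom, ∃ b ∈ α.dom,
      ∀ t, (c (flatI t) : ℝ) ∈ Set.Icc a b := by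
    intro c
    have hc : Continuous fun t : I => (c (flat t) : ℝ) :=
      (DSmooth.continuous_comp_flat (g := fun t => (c t : ℝ)) c.smooth).comp continuous_subtype_val
    obtain ⟨a, -, ha⟩ := isCompact_univ.exists_isMinOn (Set.univ_nonempty) hc.continuousOn
    obtain ⟨b, -, hb⟩ := isCompact_univ.exists_isMaxOn (Set.univ_nonempty) hc.continuousOn
    exact ⟨_, (c (flat a)).2, _, (c (flat b)).2, fun t => ⟨ha (Set.mem_univ t), hb (Set.mem_univ t)⟩⟩
  obtain ⟨a, ha, b, hb, h⟩ := aux c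
  obtain ⟨a', ha', b', hb', h'⟩ := aux c'
  have hm : min a a' ∈ α.dom := by rcases min_choice a a' with e | e <;> rwa [e]
  have hM : max b b' ∈ α.dom := by rcases max_choice b b' with e | e <;> rwa [e]
  obtain ⟨ε, hε, hball⟩ := Metric.isOpen_iff.mp α.isOpen_dom _ hM
  have hab : a ≤ b := (h 0).1.trans (h 0).2
  -- The upper bound is pushed by `ε / 2` inside the open domain, so that `m < M` even when both
  -- paths are constant.
  refine ⟨min a a', max b b' + ε / 2, ?_, hm, hball ?_, fun t => ?_, fun t => ?_⟩
  · linarith [min_le_left a a', le_max_left b b']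
  · rw [Metric.mem_ball, Real.dist_eq, add_sub_cancel_left, abs_of_pos (by linarith)]
    linarith
  · exact ⟨(min_le_left _ _).trans (h t).1, by linarith [(h t).2, le_max_left b b']⟩
  · exact ⟨(min_le_right _ _).trans (h' t).1, by linarith [(h' t).2, le_max_right b b']⟩

/-- The class of `α ∘ c`, for `c` a path in the domain of `α`, depends only on the endpoints
of `c`. -/
theorem SmoothPath.mk_compIPath_eq (α : SmoothPath X) (c c' : IPath α.dom) (h₀ : c 0 = c' 0)
    (h₁ : c 1 = c' 1) : PathClass.mk (α.compIPath c) = PathClass.mk (α.compIPath c') := by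
  obtain ⟨m, M, hmM, hm, hM, hc, hc'⟩ := α.exists_bounds c c'
  have hpos : 0 < M - m := sub_pos.mpr hmM
  -- The flattened `α ∘ d` factors through `W` by the rescaling `x ↦ (x - m) / (M - m)`, which
  -- reduces the claim to paths in `[0,1]`.
  let W : IPath X := α.segment ⟨m, hm⟩ ⟨M, hM⟩
  have key : ∀ d : IPath α.dom, (∀ t, (d (flatI t) : ℝ) ∈ Set.Icc m M) →
      ∃ e : SmoothMap I I, W.comp e = (α.compIPath d).comp flatI ∧
        ∀ t, (e t : ℝ) = (M - m)⁻¹ * d (flatI t) + -((M - m)⁻¹ * m) := by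
    intro d hd
    have hd' : DSmooth fun t => (d (flatI t) : ℝ) := d.smooth.comp flatI.smooth
    refine ⟨⟨fun t => ⟨(M - m)⁻¹ * d (flatI t) + -((M - m)⁻¹ * m), ?_, ?_⟩,
      smooth_affine hd' _ _⟩, ?_, fun t => rfl⟩
    · rw [← sub_eq_add_neg, ← mul_sub]
      exact mul_nonneg (inv_nonneg.mpr hpos.le) (sub_nonneg.mpr (hd t).1)
    · rw [← sub_eq_add_neg, ← mul_sub, inv_mul_le_iff₀ hpos]
      linarith [(hd t).2]
    · refine SmoothMap.ext (funext fun t => congrArg α.toFun (Subtype.ext ?_))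
      change ((M - m)⁻¹ * d (flatI t) + -((M - m)⁻¹ * m)) * M +
        (1 - ((M - m)⁻¹ * d (flatI t) + -((M - m)⁻¹ * m))) * m = (d (flatI t) : ℝ)
      field_simp
      ring
  obtain ⟨e, he, hev⟩ := key c hc
  obtain ⟨e', he', hev'⟩ := key c' hc'
  rw [← mk_reparam (α.compIPath c) flatI flatI_zero flatI_one,
    ← mk_reparam (α.compIPath c') flatI flatI_zero flatI_one, ← he, ← he']
  refine mk_comp_eq W e e' (Subtype.ext ?_) (Subtype.ext ?_)
  · rw [hev, hev', flatI_zero, h₀]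
  · rw [hev, hev', flatI_one, h₁]

/-- The affine path from `r` to `s` in the domain of `α`. -/
def SmoothPath.line (α : SmoothPath X) (r s : α.dom) : IPath α.dom where
  toFun t := ⟨t * s.1 + (1 - t) * r.1, by
    have h := α.ordConnected_dom.convex r.2 s.2 (sub_nonneg.mpr t.2.2) t.2.1 (by ring)
    simpa [add_comm] using h⟩
  smooth n p hp := ContDiff.isPlot (p := fun x => (p x).1 * s.1 + (1 - (p x).1) * r.1)
    (((IsPlot.contDiff (p := fun x => (p x).1) hp).mul contDiff_const).add
      ((contDiff_const.sub (IsPlot.contDiff (p := fun x => (p x).1) hp)).mul contDiff_const))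

theorem SmoothPath.line_zero (α : SmoothPath X) (r s : α.dom) : α.line r s 0 = r :=
  Subtype.ext (by simp [SmoothPath.line])

theorem SmoothPath.line_one (α : SmoothPath X) (r s : α.dom) : α.line r s 1 = s :=
  Subtype.ext (by simp [SmoothPath.line])

theorem SmoothPath.mk_segment_self (α : SmoothPath X) (r : α.dom) :
    PathClass.mk (α.segment r r) = PathClass.const (α r) := by
  refine congrArg PathClass.mk (SmoothMap.ext (funext fun t => congrArg α.toFun (Subtype.ext ?_)))
  change t.1 * r.1 + (1 - t.1) * r.1 = r.1
  ring

/-- Both sides are images under `α` of paths in its domain from `r` to `t`. The order of `r`, `s`,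
`t` is irrelevant, since backtracking is invisible to the class. -/
theorem SmoothPath.mk_segment_concat (α : SmoothPath X) (r s t : α.dom) :
    (PathClass.mk (α.segment s t)).concat (PathClass.mk (α.segment r s)) =
      PathClass.mk (α.segment r t) := by
  have h : α.line r s 1 = α.line s t 0 := (α.line_one r s).trans (α.line_zero s t).symm
  have h' : α.segment r s 1 = α.segment s t 0 := congrArg α.toFun h
  rw [PathClass.concat_mk _ _ h']
  refine Eq.trans (congrArg PathClass.mk (SmoothMap.ext (funext fun u => ?_)))
    (α.mk_compIPath_eq ((α.line s t).concat (α.line r s) h) (α.line r t) ?_ ?_)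
  · exact (apply_ite α.toFun _ _ _).symm
  · rw [IPath.concat_zero, α.line_zero, α.line_zero]
  · rw [IPath.concat_one, α.line_one, α.line_one]

/-- The left side is the image under `α` of a segment of `f`, the right side that of the straight
path with the same endpoints; `f` need not be monotone. -/
theorem SmoothPath.mk_segment_reparam (α : SmoothPath X) (f : SmoothPath α.dom) (r s : f.dom) :
    PathClass.mk ((α.reparam f).segment r s) = PathClass.mk (α.segment (f r) (f s)) := by
  refine α.mk_compIPath_eq (f.segment r s) (α.line (f r) (f s)) ?_ ?_
  · rw [f.segment_zero, α.line_zero]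
  · rw [f.segment_one, α.line_one]

variable {x₀ : X}

/-! ### The pointed path space as a principal bundle -/

/-- The loop `[α^← ∨ α']`, for classes `[α]`, `[α']` with the same target. -/
def PointedPaths.loop (a a' : PointedPaths X x₀) (h : a.target = a'.target) : LoopGroup X x₀ :=
  ⟨a.1.rev.concat a'.1, (PathClass.source_concat _ _).trans a'.2,
    (PathClass.target_concat (h.symm.trans a.1.source_rev.symm)).trans
      (a.1.target_rev.trans a.2)⟩

theorem PointedPaths.loop_smul (a a' : PointedPaths X x₀) (h : a.target = a'.target) :
    MulOpposite.op (a.loop a' h) • a = a' :=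
  Subtype.ext (PathClass.concat_rev_cancel h.symm)

theorem PointedPaths.smul_left_injective (a : PointedPaths X x₀) {g g' : LoopGroup X x₀}
    (h : MulOpposite.op g • a = MulOpposite.op g' • a) : g = g' :=
  Subtype.ext (PathClass.concat_left_cancel (g.2.2.trans a.2.symm) (g'.2.2.trans a.2.symm)
    (congrArg Subtype.val h))

/-- Smoothness of the division map of the pointed path bundle. -/
theorem PointedPaths.isPlot_loop {n : ℕ} {a a' : Euc n → PointedPaths X x₀} (ha : IsPlot a)
    (ha' : IsPlot a') (h : ∀ y, (a y).target = (a' y).target) :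
    IsPlot fun y => (a y).loop (a' y) (h y) :=
  IsPlot.pathClass_concat (b := fun y => (a y).1.rev) (a := fun y => (a' y).1)
    (IsPlot.dSmooth_comp (p := fun y => (a y).1) ha PathClass.smooth_rev) ha'
    fun y => (h y).symm.trans (a y).1.source_rev.symm

/-- Every plot of a path-connected space lifts locally to the pointed path space. -/
theorem PointedPaths.exists_local_section (hX : PathConnected X) (x₀ : X) {n : ℕ}
    {p : Euc n → X} (hp : IsPlot p) (x : Euc n) :
    ∃ a : Euc n → PointedPaths X x₀, IsPlot a ∧ ∀ y, (a y).target = p y := by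
  obtain ⟨α, s, t, hs, ht⟩ := hX x₀ (p x)
  -- The image of the straight segment from `x` to `y`. Since `p` is defined on all of `ℝⁿ`, this
  -- works for every `y`, and only the single path `α` from `x₀` to `p x` has to be chosen.
  let β : Euc n → IPath X := fun y => ⟨fun u => p (x + (u : ℝ) • (y - x)), fun m q hq =>
    isPlot_reparam hp (contDiff_const.add
      ((IsPlot.contDiff (p := fun z => (q z).1) hq).smul contDiff_const))⟩
  have hβ : IsPlot β := fun m q hq => isPlot_reparam hp (contDiff_const.add
    ((IsPlot.contDiff (p := fun z => (q z).2.1) hq.2).smul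
      ((IsPlot.contDiff hq.1).sub contDiff_const)))
  have hβ₀ : ∀ y, α.segment s t 1 = β y 0 := fun y => by
    rw [α.segment_one, ht]
    change p x = p (x + ((0 : I) : ℝ) • (y - x))
    simp
  refine ⟨fun y => ⟨PathClass.mk ((β y).concat (α.segment s t) (hβ₀ y)),
    (IPath.concat_zero _ _ _).trans ((α.segment_zero s t).trans hs)⟩,
    IsPlot.quotient_mk (IsPlot.concat hβ isPlot_const hβ₀), fun y => ?_⟩
  refine (IPath.concat_one _ _ _).trans ?_
  change p (x + ((1 : I) : ℝ) • (y - x)) = p y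
  simp

section Induced

variable {G : Type*} [Group G] (H : LoopGroup X x₀ →* G)

/-! ### Fibres of the associated bundle -/

theorem HolBundle.smul_mk (a : PointedPaths X x₀) (g k : G) :
    MulOpposite.op k • Assoc.mk H a g = Assoc.mk H a (g * k) := rfl

theorem HolBundle.proj_smul (ξ : HolBundle H) (k : G) :
    HolBundle.proj H (MulOpposite.op k • ξ) = HolBundle.proj H ξ := by
  induction ξ using Quotient.inductionOn with | _ a => rfl

/-- The loop identifying the two representatives fixes the path class `a`, hence is trivial because
loops act freely. -/
theorem HolBundle.smul_left_injective (ξ : HolBundle H) {k k' : G}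
    (h : MulOpposite.op k • ξ = MulOpposite.op k' • ξ) : k = k' := by
  induction ξ using Quotient.inductionOn with | _ a =>
  obtain ⟨a, g⟩ := a
  obtain ⟨c, hc⟩ := Quotient.exact (s := assocSetoid (PointedPaths X x₀) H) h
  obtain ⟨h₁, h₂⟩ := Prod.ext_iff.mp hc
  have hc₁ : c = 1 := a.smul_left_injective
    (h₁.symm.trans (one_smul (LoopGroup X x₀)ᵐᵒᵖ a).symm)
  subst hc₁
  change g * k' = (H 1)⁻¹ * (g * k) at h₂
  rw [map_one, inv_one, one_mul] at h₂
  exact (mul_left_cancel h₂).symm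

/-- Moving `⟦a, g k⟧` by the loop `c` with `a · c = a'` gives `⟦a', H(c)⁻¹ g k⟧`; solving `H(c)⁻¹ g
k = g'` for `k` gives the formula. -/
theorem HolBundle.mk_eq_smul_mk (a a' : PointedPaths X x₀) (h : a.target = a'.target) (g g' : G) :
    Assoc.mk H a' g' = MulOpposite.op (g⁻¹ * H (a.loop a' h) * g') • Assoc.mk H a g := by
  rw [HolBundle.smul_mk, ← Assoc.mk_smul H a (a.loop a' h), a.loop_smul]
  congr 1
  group

theorem HolBundle.exists_smul_eq (ξ ξ' : HolBundle H)
    (h : HolBundle.proj H ξ = HolBundle.proj H ξ') : ∃ k : G, MulOpposite.op k • ξ = ξ' := by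
  induction ξ using Quotient.inductionOn with | _ a =>
  induction ξ' using Quotient.inductionOn with | _ a' =>
  exact ⟨_, (HolBundle.mk_eq_smul_mk H a.1 a'.1 h a.2 a'.2).symm⟩

/-! ### Transport in the associated bundle -/

/-- The transport `⟦[β], g⟧ ↦ ⟦[α^{r → s} ∨ β], g⟧`. -/
def HolBundle.transport (α : SmoothPath X) (r s : α.dom) : HolBundle H → HolBundle H :=
  Assoc.map H (Diffeology.transport α r s) (transport_smul α r s)

/-- Reduces comparisons of transports, in particular several connection axioms, to identities
between classes of segments. -/
theorem HolBundle.transport_congr {α α' : SmoothPath X} {r s : α.dom} {r' s' : α'.dom}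
    (h : PathClass.mk (α.segment r s) = PathClass.mk (α'.segment r' s')) (ξ : HolBundle H) :
    HolBundle.transport H α r s ξ = HolBundle.transport H α' r' s' ξ := by
  induction ξ using Quotient.inductionOn with | _ a =>
  refine congrArg (fun b => Assoc.mk H b a.2) (Subtype.ext ?_)
  exact congrArg (fun c => PathClass.concat c a.1.1) h

theorem HolBundle.proj_transport {α : SmoothPath X} {r : α.dom} (s : α.dom) {ξ : HolBundle H}
    (h : HolBundle.proj H ξ = α r) :
    HolBundle.proj H (HolBundle.transport H α r s ξ) = α s := by
  induction ξ using Quotient.inductionOn with | _ a =>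
  -- Without this endpoint condition `PathClass.concat` takes its default value and leaves `a`
  -- unmoved.
  have hs : a.1.1.target = (PathClass.mk (α.segment r s)).source :=
    h.trans (α.segment_zero r s).symm
  exact (PathClass.target_concat hs).trans (α.segment_one r s)

theorem HolBundle.transport_self {α : SmoothPath X} {r : α.dom} {ξ : HolBundle H}
    (h : HolBundle.proj H ξ = α r) : HolBundle.transport H α r r ξ = ξ := by
  induction ξ using Quotient.inductionOn with | _ a =>
  refine congrArg (fun b => Assoc.mk H b a.2) (Subtype.ext ?_)
  change (PathClass.mk (α.segment r r)).concat a.1.1 = a.1.1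
  rw [α.mk_segment_self]
  exact PathClass.const_concat h

theorem HolBundle.transport_transport {α : SmoothPath X} {r : α.dom} (s t : α.dom)
    {ξ : HolBundle H} (h : HolBundle.proj H ξ = α r) :
    HolBundle.transport H α s t (HolBundle.transport H α r s ξ) =
      HolBundle.transport H α r t ξ := by
  induction ξ using Quotient.inductionOn with | _ a =>
  refine congrArg (fun b => Assoc.mk H b a.2) (Subtype.ext ?_)
  change (PathClass.mk (α.segment s t)).concat ((PathClass.mk (α.segment r s)).concat a.1.1) =
    (PathClass.mk (α.segment r t)).concat a.1.1
  rw [← α.mk_segment_concat r s t]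
  have hs : a.1.1.target = (PathClass.mk (α.segment r s)).source :=
    h.trans (α.segment_zero r s).symm
  have ht : (PathClass.mk (α.segment r s)).target = (PathClass.mk (α.segment s t)).source :=
    (α.segment_one r s).trans (α.segment_zero s t).symm
  exact (PathClass.concat_assoc hs ht).symm

theorem HolBundle.transport_smul (α : SmoothPath X) (r s : α.dom) (ξ : HolBundle H) (k : G) :
    HolBundle.transport H α r s (MulOpposite.op k • ξ) =
      MulOpposite.op k • HolBundle.transport H α r s ξ := by
  induction ξ using Quotient.inductionOn with | _ a => rfl

/-- On the constant class, concatenation on the left by `[γ]` agrees with the right action of `[γ]`,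
and the quotient relation turns that action into multiplication by `H([γ])`. -/
theorem HolBundle.transport_loop (γ : SmoothLoop X x₀) :
    HolBundle.transport H γ.toSmoothPath ⟨0, γ.zero_mem⟩ ⟨1, γ.one_mem⟩ (HolBundle.basepoint H) =
      MulOpposite.op (H γ.toLoopGroup) • HolBundle.basepoint H := by
  let b : PointedPaths X x₀ := ⟨PathClass.const x₀, rfl⟩
  have e : MulOpposite.op (H γ.toLoopGroup) • HolBundle.basepoint H =
      Assoc.mk H (MulOpposite.op γ.toLoopGroup • b) 1 :=
    (Assoc.mk_smul H b γ.toLoopGroup (1 * H γ.toLoopGroup)).symm.trans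
      (by rw [one_mul, inv_mul_cancel])
  rw [e]
  refine congrArg (fun b => Assoc.mk H b 1) (Subtype.ext ?_)
  exact (PathClass.concat_const γ.toLoopGroup.2.1).trans
    (PathClass.const_concat γ.toLoopGroup.2.2).symm

/-! ### The associated bundle is principal -/

variable [DiffeologicalSpace G]

/-- In local lifts of `ξ` and `ξ k` the element `k` is given by the division formula `g⁻¹ H([a^← ∨
b]) g'`. This is where smoothness of `H` enters. -/
theorem HolBundle.isPlot_of_smul [DiffeologicalGroup G] (hH : DSmooth H) {n : ℕ}
    {ξ : Euc n → HolBundle H} {k : Euc n → G} (hξ : IsPlot ξ)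
    (hξk : IsPlot fun y => MulOpposite.op (k y) • ξ y) : IsPlot k := by
  refine isPlot_of_local_reparam fun x => ?_
  obtain ⟨ρ, hρ, hid, a, ha, ea⟩ := IsPlot.exists_lift hξ x
  refine ⟨ρ, hid, isPlot_of_local_reparam fun x' => ?_⟩
  obtain ⟨κ, hκ, hid', b, hb, eb⟩ := IsPlot.exists_lift (isPlot_reparam hξk hρ) x'
  refine ⟨κ, hid', ?_⟩
  have hab : ∀ y, (a (κ y)).1.target = (b y).1.target := fun y => by
    have h := congrArg (HolBundle.proj H) (eb y)
    simp only [Function.comp, ea, HolBundle.proj_smul] at h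
    exact h
  have e : (fun y => k (ρ (κ y))) = fun y =>
      (a (κ y)).2⁻¹ * H ((a (κ y)).1.loop (b y).1 (hab y)) * (b y).2 := by
    funext y
    refine HolBundle.smul_left_injective H (ξ (ρ (κ y))) ((eb y).trans ?_)
    rw [ea]
    exact HolBundle.mk_eq_smul_mk H _ _ (hab y) _ _
  have haκ := isPlot_reparam ha hκ
  rw [e]
  have h₁ : IsPlot fun y => (a (κ y)).2⁻¹ :=
    IsPlot.dSmooth_comp haκ.2 (DiffeologicalGroup.smooth_inv (G := G))
  have h₂ : IsPlot fun y => H ((a (κ y)).1.loop (b y).1 (hab y)) :=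
    IsPlot.dSmooth_comp (PointedPaths.isPlot_loop haκ.1 hb.1 hab) hH
  have hmul := DiffeologicalGroup.smooth_mul (G := G)
  exact hmul n (fun y => (_, (b y).2)) ⟨hmul n (fun y => (_, _)) ⟨h₁, h₂⟩, hb.2⟩

/-- `τ_H : ℱ_{x₀}(X) ×_H G → X` is a diffeological principal bundle. -/
theorem HolBundle.isPrincipalBundle [DiffeologicalGroup G] (hX : PathConnected X)
    (hH : DSmooth H) : IsPrincipalBundle G (HolBundle.proj H) where
  smooth := HolBundle.smooth_proj H
  surjective x := by
    -- A point of `X` is viewed as a plot on `ℝ⁰`.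
    obtain ⟨a, -, ha⟩ := PointedPaths.exists_local_section hX x₀
      (isPlot_const (n := 0) (x := x)) 0
    exact ⟨Assoc.mk H (a 0) 1, ha 0⟩
  graph := by
    have hinj : Function.Injective
        fun p : HolBundle H × G => (p.1, MulOpposite.op p.2 • p.1) := by
      rintro ⟨ξ, k⟩ ⟨ξ', k'⟩ h
      obtain ⟨h₁, h₂⟩ := Prod.ext_iff.mp h
      obtain rfl : ξ = ξ' := h₁
      exact congrArg (Prod.mk ξ) (HolBundle.smul_left_injective H ξ h₂)
    refine ⟨⟨Equiv.ofInjective _ hinj, ?_, ?_⟩, fun p => rfl⟩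
    · intro n p hp
      exact ⟨hp.1, SmoothRightAction.smooth_act (G := G) n p hp⟩
    · intro n q hq
      have hr : ∀ y, (((Equiv.ofInjective _ hinj).symm (q y)).1,
          MulOpposite.op ((Equiv.ofInjective _ hinj).symm (q y)).2 •
            ((Equiv.ofInjective _ hinj).symm (q y)).1) = (q y).1 :=
        fun y => congrArg Subtype.val ((Equiv.ofInjective _ hinj).apply_symm_apply (q y))
      have hq₁ : IsPlot fun y => (q y).1.1 := hq.1
      have hq₂ : IsPlot fun y => (q y).1.2 := hq.2
      -- The components of `q` become `ξ` and `ξ k`, where `(ξ, k)` is the preimage of `q` under the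
      -- graph map, so `k` is a plot by division.
      simp only [← hr] at hq₁ hq₂
      exact ⟨hq₁, HolBundle.isPlot_of_smul H hH hq₁ hq₂⟩
  orbit := by
    -- The required diffeomorphism is the inverse of this map: the projection descends to orbits,
    -- and its inverse is smooth because plots of `X` lift.
    let Ψ : Quotient (MulAction.orbitRel Gᵐᵒᵖ (HolBundle H)) → X :=
      Quotient.lift (HolBundle.proj H) (by
        rintro _ ξ ⟨k, rfl⟩
        exact HolBundle.proj_smul H ξ k.unop)
    have hΨ : Function.Bijective Ψ := by
      refine ⟨?_, fun x => ?_⟩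
      · intro q q' h
        induction q using Quotient.inductionOn with | _ ξ =>
        induction q' using Quotient.inductionOn with | _ ξ' =>
        obtain ⟨k, hk⟩ := HolBundle.exists_smul_eq H ξ' ξ h.symm
        exact Quotient.sound ⟨MulOpposite.op k, hk⟩
      · obtain ⟨a, -, ha⟩ := PointedPaths.exists_local_section hX x₀
          (isPlot_const (n := 0) (x := x)) 0
        exact ⟨Quotient.mk _ (Assoc.mk H (a 0) 1), ha 0⟩
    refine ⟨⟨(Equiv.ofBijective Ψ hΨ).symm, ?_, ?_⟩, fun ξ => ?_⟩
    · intro n p hp x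
      obtain ⟨a, ha, e⟩ := PointedPaths.exists_local_section hX x₀ hp x
      refine ⟨fun y => Assoc.mk H (a y) 1,
        IsPlot.quotient_mk (q := fun y => (a y, (1 : G))) ⟨ha, isPlot_const⟩,
        Filter.Eventually.of_forall fun y => ?_⟩
      exact (Equiv.ofBijective Ψ hΨ).symm_apply_eq.mpr (e y).symm
    · intro n p hp
      refine isPlot_of_local_reparam fun x => ?_
      obtain ⟨ρ, -, hid, q, hq, e⟩ := IsPlot.exists_lift hp x
      refine ⟨ρ, hid, ?_⟩
      have e' : (fun y => ((Equiv.ofBijective Ψ hΨ).symm.invFun ∘ p) (ρ y)) =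
          fun y => HolBundle.proj H (q y) := by
        funext y
        exact congrArg Ψ (e y)
      rw [e']
      exact HolBundle.smooth_proj H n q hq
    · exact (Equiv.ofBijective Ψ hΨ).symm_apply_eq.mpr rfl

/-! ### The induced connection -/

/-- Joint smoothness in the path, both times and the starting point: segments depend smoothly on
path and times by evaluation, and concatenation of classes is smooth. -/
theorem HolBundle.isPlot_transport {n : ℕ} {α : Euc n → SmoothPath X} {r s : Euc n → ℝ}
    (hα : IsPlot α) (hr : ContDiff ℝ ∞ r) (hs : ContDiff ℝ ∞ s) (hr' : ∀ y, r y ∈ (α y).dom)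
    (hs' : ∀ y, s y ∈ (α y).dom) {ξ : Euc n → HolBundle H} (hξ : IsPlot ξ)
    (h : ∀ y, HolBundle.proj H (ξ y) = α y ⟨r y, hr' y⟩) :
    IsPlot fun y => HolBundle.transport H (α y) ⟨r y, hr' y⟩ ⟨s y, hs' y⟩ (ξ y) := by
  have hseg : IsPlot fun y => (α y).segment ⟨r y, hr' y⟩ ⟨s y, hs' y⟩ := by
    intro m q hq
    have c₁ : ContDiff ℝ ∞ fun z => (q z).1 := IsPlot.contDiff hq.1
    have c₂ : ContDiff ℝ ∞ fun z => (q z).2.1 := IsPlot.contDiff (p := fun z => (q z).2.1) hq.2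
    exact IsPlot.path_eval (isPlot_reparam hα c₁)
      ((c₂.mul (hs.comp c₁)).add ((contDiff_const.sub c₂).mul (hr.comp c₁)))
      fun z => ((α (q z).1).line ⟨r (q z).1, hr' _⟩ ⟨s (q z).1, hs' _⟩ (q z).2).2
  refine isPlot_of_local_reparam fun x => ?_
  obtain ⟨ρ, hρ, hid, a, ha, ea⟩ := IsPlot.exists_lift hξ x
  refine ⟨ρ, hid, ?_⟩
  simp only [ea]
  refine IsPlot.quotient_mk (q := fun y => (Diffeology.transport (α (ρ y)) ⟨r (ρ y), hr' _⟩
    ⟨s (ρ y), hs' _⟩ (a y).1, (a y).2)) ⟨?_, ha.2⟩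
  refine IsPlot.pathClass_concat (a := fun y => (a y).1.1)
    (IsPlot.quotient_mk (isPlot_reparam hseg hρ)) ha.1 fun y => ?_
  have h' := h (ρ y)
  rw [ea] at h'
  exact h'.trans ((α (ρ y)).segment_zero _ _).symm

theorem SmoothPath.isPlot_map {Y Z : Type*} [DiffeologicalSpace Y] [DiffeologicalSpace Z]
    {n : ℕ} {p : Euc n → SmoothPath Y} (hp : IsPlot p) {f : Y → Z} (hf : DSmooth f) :
    IsPlot fun y => (p y).map f hf := by
  intro r₀ s₀ hs
  obtain ⟨V, W, h, hV, hW, hr, hs', hVW⟩ := hp r₀ s₀ hs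
  exact ⟨V, W, h, hV, hW, hr, hs', hf.comp hVW⟩

theorem SmoothPath.ext_of_dom_eq {Y : Type*} [DiffeologicalSpace Y] {α β : SmoothPath Y}
    (h : α.dom = β.dom) (h' : ∀ s (hs : s ∈ α.dom) (hs' : s ∈ β.dom), α ⟨s, hs⟩ = β ⟨s, hs'⟩) :
    α = β := by
  obtain ⟨d, _, _, _, f, _⟩ := α
  obtain ⟨d', _, _, _, f', _⟩ := β
  obtain rfl : d = d' := h
  obtain rfl : f = f' := funext fun s => h' s.1 s.2 s.2
  rfl

theorem smooth_inducedConnection : DSmooth (inducedConnection H) := by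
  intro n p hp r₀ s₀ hs₀
  -- The connection does not change domains, so the neighbourhoods for the given paths also serve
  -- for their images.
  obtain ⟨V, W, hVW, hV, hW, hr, hs, -⟩ := hp.1 r₀ s₀ hs₀
  refine ⟨V, W, hVW, hV, hW, hr, hs, fun m q hq => ?_⟩
  have c₁ : ContDiff ℝ ∞ fun z => (q z).1.1 := IsPlot.contDiff (p := fun z => (q z).1.1) hq.1
  have c₂ : ContDiff ℝ ∞ fun z => (q z).2.1 := IsPlot.contDiff (p := fun z => (q z).2.1) hq.2
  have hp₁ := isPlot_reparam (p := fun y => (p y).1.1) hp.1 c₁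
  have hp₂ : ContDiff ℝ ∞ fun z => (p (q z).1.1).1.2 :=
    (IsPlot.contDiff (p := fun y => (p y).1.2) hp.2).comp c₁
  exact HolBundle.isPlot_transport H
    (SmoothPath.isPlot_map hp₁ (HolBundle.smooth_proj H)) hp₂ c₂
    (fun z => (p (q z).1.1).2) (fun z => hVW _ (q z).1.2 (q z).2.2)
    (IsPlot.path_eval hp₁ hp₂ fun z => (p (q z).1.1).2) fun z => rfl

/-- `Θ^H` is a diffeological connection. -/
theorem isConnection_inducedConnection [DiffeologicalGroup G] :
    IsConnection G (HolBundle.proj H) (inducedConnection H) where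
  smooth := smooth_inducedConnection H
  domain _ := rfl
  lifting p s h _ := HolBundle.proj_transport H
    (α := p.path.map _ (HolBundle.smooth_proj H)) (r := p.time) ⟨s, h⟩ rfl
  basepoint p _ := HolBundle.transport_self H
    (α := p.path.map _ (HolBundle.smooth_proj H)) (r := p.time) rfl
  equivariant α t ρ hρ s h h' := by
    -- The paths `α · ρ` and `α` have the same projection, so the same segment is used and `ρ`
    -- matters only through the starting value at `t`.
    refine Eq.trans ?_ (HolBundle.transport_smul H (α.map _ (HolBundle.smooth_proj H)) t ⟨s, h'⟩
      (α t) (ρ t))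
    refine HolBundle.transport_congr H (congrArg PathClass.mk (SmoothMap.ext (funext fun u => ?_))) _
    exact HolBundle.proj_smul H _ _
  reparam α f t s h h' := HolBundle.transport_congr H
    ((α.map _ (HolBundle.smooth_proj H)).mk_segment_reparam f t s) _
  projection p h := by
    refine SmoothPath.ext_of_dom_eq rfl fun s hs hs' => ?_
    have e : inducedConnection H p ⟨p.time.1, h⟩ = p.path p.time := HolBundle.transport_self H
      (α := p.path.map _ (HolBundle.smooth_proj H)) (r := p.time) rfl
    -- The transported path has the same projection and the same value at the initial time as the
    -- original one, and these two data determine the result.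
    refine Eq.trans (HolBundle.transport_congr H
      (α' := p.path.map _ (HolBundle.smooth_proj H)) (r' := p.time) (s' := ⟨s, hs'⟩)
      (congrArg PathClass.mk (SmoothMap.ext (funext fun u => ?_))) _)
      (congrArg (HolBundle.transport H (p.path.map _ (HolBundle.smooth_proj H)) p.time ⟨s, hs'⟩) e)
    exact HolBundle.proj_transport H (α := p.path.map _ (HolBundle.smooth_proj H)) (r := p.time)
      _ rfl

/-! ### Horizontal paths and holonomy -/

/-- Horizontality at one time `t` spreads to all times: `β r` and `β s` are both transported from `β
t`, and transports compose. -/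
theorem IsHorizontal.transport_eq {β : SmoothPath (HolBundle H)}
    (hβ : IsHorizontal (inducedConnection H) β) (r s : β.dom) :
    HolBundle.transport H (β.map _ (HolBundle.smooth_proj H)) r s (β r) = β s := by
  obtain ⟨t, ht⟩ := hβ
  have key : ∀ u : β.dom,
      β u = HolBundle.transport H (β.map _ (HolBundle.smooth_proj H)) t u (β t) := by
    -- Evaluation of an equality of paths, stated for a free `β'` because the domain varies with the
    -- path.
    have aux : ∀ (β' : SmoothPath (HolBundle H)), β' = β → ∀ (u : β.dom) (h : u.1 ∈ β'.dom),
        β u = β' ⟨u.1, h⟩ := by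
      rintro _ rfl u h
      rfl
    exact fun u => aux _ ht u u.2
  rw [key r, key s]
  exact HolBundle.transport_transport H (α := β.map _ (HolBundle.smooth_proj H)) r s rfl

theorem HolBundle.smooth_transport (α : SmoothPath X) (r : α.dom) (ξ : HolBundle H) :
    DSmooth fun s => HolBundle.transport H α r s ξ := by
  induction ξ using Quotient.inductionOn with | _ a =>
  intro n q hq
  exact IsPlot.quotient_mk (q := fun y => (Diffeology.transport α r (q y) a.1, a.2))
    ⟨Diffeology.smooth_transport α r a.1 n q hq, isPlot_const⟩

/-- The lift `s ↦ ⟦[α^{r → s} ∨ β], g⟧` of `α`. -/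
def HolBundle.lift (α : SmoothPath X) (r : α.dom) (ξ : HolBundle H) :
    SmoothPath (HolBundle H) where
  dom := α.dom
  isOpen_dom := α.isOpen_dom
  ordConnected_dom := α.ordConnected_dom
  nonempty_dom := α.nonempty_dom
  toFun s := HolBundle.transport H α r s ξ
  smooth := HolBundle.smooth_transport H α r ξ

/-- The lift lies over `α` and has value `ξ` at `r`, so applying the connection at time `r`
transports `ξ` along `α` again and reproduces the lift. -/
theorem HolBundle.isHorizontalLift_lift {α : SmoothPath X} {r : α.dom} {ξ : HolBundle H}
    (h : HolBundle.proj H ξ = α r) :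
    IsHorizontalLift (HolBundle.proj H) (inducedConnection H) α r.1 ξ
      (HolBundle.lift H α r ξ) := by
  have hr : HolBundle.lift H α r ξ r = ξ := HolBundle.transport_self H h
  refine ⟨⟨r, ?_⟩, rfl, fun s _ hs => HolBundle.proj_transport H ⟨s, hs⟩ h, r.2, hr⟩
  refine SmoothPath.ext_of_dom_eq rfl fun s hs hs' => ?_
  refine Eq.trans (HolBundle.transport_congr H (α' := α) (r' := r) (s' := ⟨s, hs'⟩)
    (congrArg PathClass.mk (SmoothMap.ext (funext fun u => ?_))) _)
    (congrArg (HolBundle.transport H α r ⟨s, hs'⟩) hr)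
  exact HolBundle.proj_transport H _ h

/-- Any horizontal lift ends at the transport of its initial point, and the free action of `G` then
determines `g`; conversely the transport lift realizes `H([γ])`. -/
theorem hasHolonomy_iff (γ : SmoothLoop X x₀) (g : G) :
    HasHolonomy (HolBundle.proj H) (inducedConnection H) (HolBundle.basepoint H) γ g ↔
      g = H γ.toLoopGroup := by
  constructor
  · rintro ⟨β, ⟨hβ, hdom, hlift, h₀, hβ₀⟩, h₁, hβ₁⟩
    refine HolBundle.smul_left_injective H (HolBundle.basepoint H) ?_
    rw [← hβ₁, ← HolBundle.transport_loop, ← IsHorizontal.transport_eq H hβ ⟨0, h₀⟩ ⟨1, h₁⟩, hβ₀]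
    refine HolBundle.transport_congr H (congrArg PathClass.mk (SmoothMap.ext (funext fun u => ?_))) _
    exact hlift _ _ _
  · rintro rfl
    exact ⟨HolBundle.lift H γ.toSmoothPath ⟨0, γ.zero_mem⟩ (HolBundle.basepoint H),
      HolBundle.isHorizontalLift_lift H (r := ⟨0, γ.zero_mem⟩) γ.map_zero.symm, γ.one_mem,
      HolBundle.transport_loop H γ⟩

end Induced

/-! ### Loop classes as classes of smooth loops -/

/-- A path `η` on `[0,1]` need not extend smoothly beyond it, but `η ∘ flat` is defined on the whole
line, and its restriction to `[0,1]` is a reparametrization of `η`. -/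
theorem SmoothLoop.toLoopGroup_surjective :
    Function.Surjective (SmoothLoop.toLoopGroup : SmoothLoop X x₀ → LoopGroup X x₀) := by
  rintro ⟨c, h₀, h₁⟩
  induction c using Quotient.inductionOn with | _ η =>
  refine ⟨⟨⟨Set.univ, isOpen_univ, Set.ordConnected_univ, Set.univ_nonempty,
    fun t => η (flat t), ?_⟩, trivial, trivial, ?_, ?_⟩, Subtype.ext ?_⟩
  · exact (η.smooth.comp flat_smooth).comp fun _ _ hp => hp
  · exact (congrArg η.toFun flatI_zero).trans h₀
  · exact (congrArg η.toFun flatI_one).trans h₁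
  · refine Eq.trans (congrArg PathClass.mk (SmoothMap.ext (funext fun t => ?_)))
      (mk_reparam η flatI flatI_zero flatI_one)
    change η (flat (t.1 * 1 + (1 - t.1) * 0)) = η (flat t.1)
    rw [mul_one, mul_zero, add_zero]

end PathClasses
end Diffeology
end

/-! ### The Kobayashi theorem -/

theorem mainTheorem3 {X G : Type*} [DiffeologicalSpace X] [Group G] [DiffeologicalSpace G]
    [DiffeologicalGroup G] (hX : PathConnected X) (x₀ : X) (H : LoopGroup X x₀ →* G)
    (hH : DSmooth H) :
    IsPrincipalBundle G (HolBundle.proj H) ∧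
    IsConnection G (HolBundle.proj H) (inducedConnection H) ∧
    HolBundle.proj H (HolBundle.basepoint H) = x₀ ∧
    (∀ (γ : SmoothLoop X x₀) (g : G),
      HasHolonomy (HolBundle.proj H) (inducedConnection H) (HolBundle.basepoint H) γ g ↔
        g = H γ.toLoopGroup) ∧
    (∀ c : LoopGroup X x₀, ∃ γ : SmoothLoop X x₀, γ.toLoopGroup = c) ∧
    holonomyGroup G (HolBundle.proj H) (inducedConnection H) (HolBundle.basepoint H) =
      (H.range : Set G) := by
  refine ⟨HolBundle.isPrincipalBundle H hX hH, isConnection_inducedConnection H, rfl,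
    hasHolonomy_iff H, SmoothLoop.toLoopGroup_surjective, Set.ext fun g => ⟨?_, ?_⟩⟩
  · rintro ⟨γ, hγ⟩
    -- The loop is based at the projection of `⟦•, e⟧`, which is `x₀` by definition.
    exact ⟨SmoothLoop.toLoopGroup (x₀ := x₀) γ, ((hasHolonomy_iff H γ g).mp hγ).symm⟩
  · rintro ⟨c, rfl⟩
    obtain ⟨γ, rfl⟩ := SmoothLoop.toLoopGroup_surjective c
    exact ⟨γ, (hasHolonomy_iff H γ _).mpr rfl⟩
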